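/- **Setting.** Let $Z=(Z,d,\mu)$ be a separable metric space with a Borel measure $\mu$ such that $0<\mu(B(z,r))<\infty$ for all $z\in Z$, $0<r<\infty$, where $B(z,r)=\{y: d(z,y)<r\}$. Assume that $Z$ is locally complete (every point has a complete neighbourhood) and that $\mu$ is infinitesimally doubling, i.e. $\limsup_{r\to0^+}\mu(B(z,2r))/\mu(B(z,r))<\infty$ for $\mu$-almost every $z\in Z$. **Definitions.** A curve is a continuous map $\gamma:[a,b]\to Z$, and $\ell(\gamma)$ is its length; if $\ell(\gamma)<\infty$ and $\rho:Z\to[0,\infty]$ is Borel, then $\int_\gamma\rho\,ds=\int_0^{\ell(\gamma)}\rho(\widehat\gamma(s))\,ds$, where $\widehat\gamma$ is the unit speed reparametrization of $\gamma$. A family $\Gamma$ of curves is *$\infty$-negligible* if there is a Borel function $\rho:Z\to[0,\infty]$ with $\rho=0$ $\mu$-a.e. and $\int_\gamma\rho\,ds=\infty$ for every rectifiable $\gamma\in\Gamma$. A Borel function $\rho:Z\to[0,\infty]$ is an *$\infty$-weak upper gradient* of $u:Z\to\mathbb R$ if the family of nonconstant curves $\gamma:[a,b]\to Z$ for which $|u(\gamma(a))-u(\gamma(b))|\le\int_\gamma\rho\,ds$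 fails is $\infty$-negligible. $W^{1,\infty}(Z)$ is the set of $u\in L^\infty(Z)$ that agree a.e. with a function $\widehat u:Z\to\mathbb R$ having an essentially bounded $\infty$-weak upper gradient, and $\|u\|_{W^{1,\infty}(Z)}=\|u\|_{L^\infty(Z)}+\inf_\rho\|\rho\|_{L^\infty(Z)}$, the infimum being over the essentially bounded $\infty$-weak upper gradients $\rho$ of $\widehat u$ (it does not depend on the choice of $\widehat u$). ${\rm LIP}^\infty(Z)$ is the space of bounded Lipschitz functions with norm $\|u\|_{{\rm LIP}^\infty(Z)}=\|u\|_{L^\infty(Z)}+{\rm lip}(u)$, where ${\rm lip}(u)$ is the smallest Lipschitz constant of $u$; it is regarded as a subset of $L^\infty(Z)$. For $C>0$, $\lambda\ge1$, $r\in(0,\infty]$, $Z$ supports a *weak $(1,\infty)$-Poincaré inequality up to scale $r$ with constants $(C,\lambda)$* if for every ball $B=B(x,s)$ with $0<s<\infty$, $s\le r$, every $u:Z\to\mathbb R$ that is integrable on bounded sets, and every $\infty$-weak upper gradient $\rho$ of $u$, $$\frac1{\mu(B)}\int_B|u-u_B|\,d\mu\le C\,{\rm diam}(B)\,\|\rho\|_{L^\infty(\lambda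 B)},\qquad u_B=\frac1{\mu(B)}\int_Bu\,d\mu,\quad \lambda B=B(x,\lambda s),$$ with the convention $0\cdot\infty=0$. The measure $\mu$ is *$C_\mu$-doubling up to scale $R'\in(0,\infty]$* if $\mu(B(z,2r))\le C_\mu\,\mu(B(z,r))$ for all $z\in Z$ and $0<r<R'$. **Theorem.** For $c>0$, and for $C\ge1$ and $R\in(0,\infty]$, consider the conditions 1. $(1)_c$: ${\rm LIP}^\infty(Z)=W^{1,\infty}(Z)$ as subsets of $L^\infty(Z)$, and $c\,\|u\|_{{\rm LIP}^\infty(Z)}\le\|u\|_{W^{1,\infty}(Z)}$ for every $u\in W^{1,\infty}(Z)$; 2. $(2)_{C,R}$: $Z$ is very $\infty$-thick $(C,R)$-quasiconvex: for every $x_0\in Z$ and all $x,y\in B(x_0,R)$, the family of curves $\gamma:[0,1]\to Z$ with $\gamma(0)=x$, $\gamma(1)=y$ and $\ell(\gamma)\le C\,d(x,y)$ is not $\infty$-negligible (equivalently, for every $\infty$-negligible family $\Gamma_0$, it contains a curve that is not in $\Gamma_0$). The two conditions are quantitatively equivalent: for every $c>0$ there are $C\ge1$ and $R\in(0,\infty]$,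 depending only on $c$, such that $(1)_c$ implies $(2)_{C,R}$ for every $Z$ as above; and for all $C\ge1$, $R\in(0,\infty]$ there is $c>0$, depending only on $C$ and $R$, such that $(2)_{C,R}$ implies $(1)_c$ for every $Z$ as above. Moreover, either of $(1)_c$ and $(2)_{C,R}$ implies that $Z$ supports a weak $(1,\infty)$-Poincaré inequality up to some scale $r\in(0,\infty]$, where $r$ and the constants of the inequality depend only on $c$, respectively only on $C$ and $R$. Conversely, if $\mu$ is $C_\mu$-doubling up to scale $r_1\in(0,\infty]$ and $Z$ supports a weak $(1,\infty)$-Poincaré inequality up to scale $r_2\in(0,\infty]$ with constants $(K,\lambda)$, then $(2)_{C,R}$ holds with some $C\ge1$ and $R\in(0,\infty]$ that depend only on $C_\mu,K,\lambda,r_1,r_2$. -/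

import Mathlib

open MeasureTheory Set Filter Topology
open scoped ENNReal NNReal

universe u

noncomputable section

/-- Every point has a complete neighbourhood. -/
def LocallyComplete (Z : Type*) [MetricSpace Z] : Prop :=
  ∀ z : Z, ∃ s ∈ 𝓝 z, IsComplete s

/-- `limsup_{r → 0+} μ(B(z,2r)) / μ(B(z,r)) < ∞` for `μ`-almost every `z`. -/
def InfinitesimallyDoubling {Z : Type*} [MetricSpace Z] [MeasurableSpace Z]
    (μ : Measure Z) : Prop :=
  ∀ᵐ z ∂μ, limsup (fun r : ℝ => μ (Metric.ball z (2 * r)) / μ (Metric.ball z r)) (𝓝[>] 0) < ∞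

/-- Every ball of positive (finite) radius has positive and finite measure. -/
def FinitePositiveOnBalls {Z : Type*} [MetricSpace Z] [MeasurableSpace Z]
    (μ : Measure Z) : Prop :=
  ∀ (z : Z) (r : ℝ), 0 < r → 0 < μ (Metric.ball z r) ∧ μ (Metric.ball z r) < ∞

/-- The standing assumptions on the metric measure space `(Z, μ)`. -/
structure StandingAssumptions {Z : Type*} [MetricSpace Z] [MeasurableSpace Z]
    (μ : Measure Z) : Prop where
  locallyComplete : LocallyComplete Z
  infinitesimallyDoubling : InfinitesimallyDoubling μ
  finitePositiveOnBalls : FinitePositiveOnBalls μ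

/-- `μ` is `D`-doubling up to scale `R`: `μ(B(z,2r)) ≤ D μ(B(z,r))` for all `r ∈ (0,R)`. -/
def DoublingUpToScale {Z : Type*} [MetricSpace Z] [MeasurableSpace Z]
    (μ : Measure Z) (D : ℝ≥0) (R : ℝ≥0∞) : Prop :=
  ∀ (z : Z) (r : ℝ), 0 < r → ENNReal.ofReal r < R →
    μ (Metric.ball z (2 * r)) ≤ D * μ (Metric.ball z r)

/-! ### Curves -/

/-- A curve `[a, b] → Z`, `a ≤ b`. The values of `toFun` outside `[a, b]` play no role. -/
structure MetricCurve (Z : Type*) [MetricSpace Z] where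
  a : ℝ
  b : ℝ
  a_le_b : a ≤ b
  toFun : ℝ → Z
  continuousOn : ContinuousOn toFun (Icc a b)

namespace MetricCurve

variable {Z : Type*} [MetricSpace Z]

/-- The initial point of the curve. -/
def source (γ : MetricCurve Z) : Z := γ.toFun γ.a

/-- The terminal point of the curve. -/
def target (γ : MetricCurve Z) : Z := γ.toFun γ.b

/-- The length `ℓ(γ)`. -/
def length (γ : MetricCurve Z) : ℝ≥0∞ := eVariationOn γ.toFun (Icc γ.a γ.b)

/-- Curves of finite length. -/
def Rectifiable (γ : MetricCurve Z) : Prop := γ.length < ∞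

/-- The curve is a constant map on `[a, b]`. -/
def IsConstant (γ : MetricCurve Z) : Prop := ∀ t ∈ Icc γ.a γ.b, γ.toFun t = γ.source

/-- The unit speed reparametrization of a rectifiable curve, to be used on `[0, ℓ(γ)]`:
at `s` it takes the value `γ(t)` for any `t` such that `γ` restricted to `[a, t]` has length `s`. -/
def unitSpeed (γ : MetricCurve Z) : ℝ → Z :=
  naturalParameterization γ.toFun (Icc γ.a γ.b) γ.a

/-- The curve integral `∫_γ ρ ds` of `ρ` over a rectifiable curve `γ`. -/
def lineIntegral (γ : MetricCurve Z) (ρ : Z → ℝ≥0∞) : ℝ≥0∞ :=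
  ∫⁻ s in Icc 0 γ.length.toReal, ρ (γ.unitSpeed s)

end MetricCurve

/-- The curve family `Γ` is `∞`-negligible: there is a nonnegative Borel function that vanishes
almost everywhere and whose integral over each rectifiable curve of `Γ` is infinite. -/
def InftyNegligible {Z : Type*} [MetricSpace Z] [MeasurableSpace Z] (μ : Measure Z)
    (Γ : Set (MetricCurve Z)) : Prop :=
  ∃ ρ : Z → ℝ≥0∞, Measurable ρ ∧ ρ =ᵐ[μ] 0 ∧
    ∀ γ ∈ Γ, γ.Rectifiable → γ.lineIntegral ρ = ∞

/-- `Γ(x, y; C)`: the curves `γ : [0,1] → Z` from `x` to `y` with `ℓ(γ) ≤ C d(x, y)`. -/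
def quasiconvexCurves {Z : Type*} [MetricSpace Z] (x y : Z) (C : ℝ≥0) : Set (MetricCurve Z) :=
  {γ | γ.a = 0 ∧ γ.b = 1 ∧ γ.source = x ∧ γ.target = y ∧ γ.length ≤ C * edist x y}

/-- `Z` is very `∞`-thick `(C, R)`-quasiconvex. -/
def VeryInftyThickQuasiconvex {Z : Type*} [MetricSpace Z] [MeasurableSpace Z]
    (μ : Measure Z) (C : ℝ≥0) (R : ℝ≥0∞) : Prop :=
  ∀ x₀ : Z, ∀ x ∈ Metric.eball x₀ R, ∀ y ∈ Metric.eball x₀ R,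
    ¬ InftyNegligible μ (quasiconvexCurves x y C)

/-! ### Newton--Sobolev functions -/

/-- `ρ` is an `∞`-weak upper gradient of `u`: `ρ` is Borel and
`|u(γ(a)) - u(γ(b))| ≤ ∫_γ ρ ds` for `∞`-almost every nonconstant curve `γ`. -/
def IsInftyWeakUpperGradient {Z : Type*} [MetricSpace Z] [MeasurableSpace Z] (μ : Measure Z)
    (u : Z → ℝ) (ρ : Z → ℝ≥0∞) : Prop :=
  Measurable ρ ∧ InftyNegligible μ
    {γ | ¬ γ.IsConstant ∧ ¬ edist (u γ.source) (u γ.target) ≤ γ.lineIntegral ρ}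

/-- The essentially bounded `∞`-weak upper gradients of `u`. -/
def boundedWeakUpperGradients {Z : Type*} [MetricSpace Z] [MeasurableSpace Z] (μ : Measure Z)
    (u : Z → ℝ) : Set (Z → ℝ≥0∞) :=
  {ρ | IsInftyWeakUpperGradient μ u ρ ∧ essSup ρ μ < ∞}

/-- The class of pointwise defined Newton--Sobolev functions: essentially bounded (measurable)
functions with an essentially bounded `∞`-weak upper gradient. -/
def newtonFunctions {Z : Type*} [MetricSpace Z] [MeasurableSpace Z] (μ : Measure Z) :
    Set (Z → ℝ) :=
  {u | MemLp u ∞ μ ∧ (boundedWeakUpperGradients μ u).Nonempty}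

/-- `‖u‖_{L^∞}` plus the infimum of `‖ρ‖_{L^∞}` over the `∞`-weak upper gradients `ρ` of `u`. -/
def newtonNorm {Z : Type*} [MetricSpace Z] [MeasurableSpace Z] (μ : Measure Z)
    (u : Z → ℝ) : ℝ≥0∞ :=
  eLpNorm u ∞ μ + ⨅ ρ ∈ boundedWeakUpperGradients μ u, essSup ρ μ

/-- `W^{1,∞}(Z)`: the elements of `L^∞(Z)` with a Newton--Sobolev representative. -/
def sobolevSpace {Z : Type*} [MetricSpace Z] [MeasurableSpace Z] (μ : Measure Z) :
    Set (Lp ℝ ∞ μ) :=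
  {u | ∃ v ∈ newtonFunctions μ, u =ᵐ[μ] v}

/-- The norm of `W^{1,∞}(Z)`: the Newton--Sobolev norm of a Newton--Sobolev representative.
(Any two such representatives have the same norm, so the infimum is over one value.) -/
def sobolevNorm {Z : Type*} [MetricSpace Z] [MeasurableSpace Z] (μ : Measure Z)
    (u : Lp ℝ ∞ μ) : ℝ≥0∞ :=
  ⨅ v ∈ {v : Z → ℝ | v ∈ newtonFunctions μ ∧ u =ᵐ[μ] v}, newtonNorm μ v

/-! ### Bounded Lipschitz functions -/

/-- The smallest Lipschitz constant of `f` (`∞` if `f` is not Lipschitz). -/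
def lipConst {Z : Type*} [MetricSpace Z] (f : Z → ℝ) : ℝ≥0∞ :=
  ⨅ K ∈ {K : ℝ≥0 | LipschitzWith K f}, (K : ℝ≥0∞)

/-- `LIP^∞(Z)`, embedded in `L^∞(Z)`: the classes with a Lipschitz representative. -/
def lipSpace {Z : Type*} [MetricSpace Z] [MeasurableSpace Z] (μ : Measure Z) :
    Set (Lp ℝ ∞ μ) :=
  {u | ∃ f : Z → ℝ, (∃ K : ℝ≥0, LipschitzWith K f) ∧ u =ᵐ[μ] f}

/-- The norm `‖f‖_{L^∞} + lip(f)` of the Lipschitz representative `f` of a class in `LIP^∞(Z)`.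
(When all balls have positive measure, this representative is unique.) -/
def lipNorm {Z : Type*} [MetricSpace Z] [MeasurableSpace Z] (μ : Measure Z)
    (u : Lp ℝ ∞ μ) : ℝ≥0∞ :=
  ⨅ f ∈ {f : Z → ℝ | (∃ K : ℝ≥0, LipschitzWith K f) ∧ u =ᵐ[μ] f},
    (eLpNorm f ∞ μ + lipConst f)

/-- `LIP^∞(Z) = W^{1,∞}(Z)`, and `c ‖u‖_{LIP^∞} ≤ ‖u‖_{W^{1,∞}}` for every `u ∈ W^{1,∞}(Z)`. -/
def LipEqSobolev {Z : Type*} [MetricSpace Z] [MeasurableSpace Z]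
    (μ : Measure Z) (c : ℝ≥0) : Prop :=
  lipSpace μ = sobolevSpace μ ∧ ∀ u ∈ sobolevSpace μ, c * lipNorm μ u ≤ sobolevNorm μ u

/-! ### Poincaré inequality -/

/-- The weak `(1,∞)`-Poincaré inequality up to scale `R` with constants `(C, τ)`:
`⨍_B |u - u_B| dμ ≤ C diam(B) ‖ρ‖_{L^∞(τB)}` for all balls `B` of radius at most `R`, all `u`
integrable on bounded sets, and all `∞`-weak upper gradients `ρ` of `u`. -/
def WeakPoincareUpToScale {Z : Type*} [MetricSpace Z] [MeasurableSpace Z]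
    (μ : Measure Z) (C τ : ℝ≥0) (R : ℝ≥0∞) : Prop :=
  ∀ (x : Z) (r : ℝ), 0 < r → ENNReal.ofReal r ≤ R →
    ∀ u : Z → ℝ, (∀ s : Set Z, Bornology.IsBounded s → IntegrableOn u s μ) →
      ∀ ρ : Z → ℝ≥0∞, IsInftyWeakUpperGradient μ u ρ →
        (⨍⁻ y in Metric.ball x r, edist (u y) (⨍ z in Metric.ball x r, u z ∂μ) ∂μ)
          ≤ C * Metric.ediam (Metric.ball x r) *
            essSup ρ (μ.restrict (Metric.ball x (τ * r)))

end

/-! Condition (1), and likewise doubling together with a Poincaré inequality, enter the proof of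
thick quasiconvexity through one consequence only: continuous functions with values in a fixed
interval `[0, M]` and a weak upper gradient at most `1` a.e. are `K`-Lipschitz at some scale
(`LipEqSobolev.abs_sub_le`, `abs_sub_le_of_doubling_of_poincare`). Continuity is what makes this
available at every point instead of almost every point.

From this, `veryInftyThickQuasiconvex_of_forall_continuous` builds curves. If a Borel `ρ` vanishes
a.e., a short curve from `x` to `y` spending no time in the null set `E = {ρ ≠ 0}` shows that `ρ`
does not witness negligibility. The test function is the cheapest cost of going from `p` to `q` by
paths that spend no time in `E`, charged by duration, and by short jumps, charged `Λ` times their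
size. Jumps make it continuous; free use of paths avoiding `E` makes `1 + ∞ · 1_E` an upper
gradient. So the cost is at most `K d(p, q)`, and for `Λ = 2(K + 1)` some chain has jumps of total
size at most `d(p, q) / 2`. Replacing every jump by such a chain, over and over, halves the total
jump size and the time possibly spent in `E`. Local completeness yields a limit curve, which spends
no time in `E` (`exists_isAvoidingPath_of_chains`).

In the other direction, `edist_le_of_not_inftyNegligible` integrates an upper gradient along a
non-exceptional quasiconvex curve. This bounds oscillations pointwise, giving both the Poincaré
inequality and the Lipschitz estimate. -/

/-! ### Unit speed reparametrization -/

/-- The variation function of a continuous function of locally bounded variation is continuous. -/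
theorem LocallyBoundedVariationOn.continuousOn_variationOnFromTo {Z : Type*} [PseudoMetricSpace Z]
    {f : ℝ → Z} {s : Set ℝ} (hf : LocallyBoundedVariationOn f s) (hc : ContinuousOn f s) {a : ℝ}
    (ha : a ∈ s) : ContinuousOn (variationOnFromTo f s a) s := by
  intro x hx
  -- The one-sided limits of the variation differ from its value by the jumps of `f`, which vanish
  -- by continuity.
  have hl := variationOnFromTo.tendsto_left ha hx hf
    ((hc x hx).mono_left (nhdsWithin_mono _ inter_subset_left))
  have hr := variationOnFromTo.tendsto_right ha hx hf
    ((hc x hx).mono_left (nhdsWithin_mono _ inter_subset_left))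
  rw [dist_self, sub_zero] at hl
  rw [dist_self, add_zero] at hr
  have hs : s = insert x ((s ∩ Iio x) ∪ (s ∩ Ioi x)) := by
    ext y
    simp only [mem_insert_iff, mem_union, mem_inter_iff, mem_Iio, mem_Ioi]
    rcases lt_trichotomy y x with h | h | h
    · simp [h, h.ne, h.not_gt]
    · simp [h, hx]
    · simp [h, h.ne', h.not_gt]
  rw [hs, continuousWithinAt_insert_self, ← hs]
  exact ContinuousWithinAt.union hl hr

namespace MetricCurve

variable {Z : Type*} [MetricSpace Z] {γ : MetricCurve Z}

/-- The length of `γ` restricted to `[a, t]`. -/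
noncomputable def arcLength (γ : MetricCurve Z) (t : ℝ) : ℝ :=
  variationOnFromTo γ.toFun (Icc γ.a γ.b) γ.a t

theorem Rectifiable.locallyBoundedVariationOn (hγ : γ.Rectifiable) :
    LocallyBoundedVariationOn γ.toFun (Icc γ.a γ.b) :=
  BoundedVariationOn.locallyBoundedVariationOn (ne_of_lt hγ)

theorem arcLength_left (γ : MetricCurve Z) : γ.arcLength γ.a = 0 :=
  variationOnFromTo.self _ _ _

theorem arcLength_right (γ : MetricCurve Z) : γ.arcLength γ.b = γ.length.toReal := by
  rw [arcLength, variationOnFromTo.eq_of_le _ _ γ.a_le_b, inter_self, length]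

/-- Arc length is monotone and continuous, so the intermediate value theorem applies. Every unit
speed parameter is therefore the arc length of some `t`, which lets claims about `unitSpeed` be
pulled back to `γ`. -/
theorem Rectifiable.arcLength_image (hγ : γ.Rectifiable) :
    γ.arcLength '' Icc γ.a γ.b = Icc 0 γ.length.toReal := by
  have ha : γ.a ∈ Icc γ.a γ.b := left_mem_Icc.2 γ.a_le_b
  have hb : γ.b ∈ Icc γ.a γ.b := right_mem_Icc.2 γ.a_le_b
  have hmono : MonotoneOn γ.arcLength (Icc γ.a γ.b) :=
    variationOnFromTo.monotoneOn hγ.locallyBoundedVariationOn ha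
  rw [← γ.arcLength_left, ← γ.arcLength_right]
  refine Subset.antisymm ?_ (intermediate_value_Icc γ.a_le_b
    (hγ.locallyBoundedVariationOn.continuousOn_variationOnFromTo γ.continuousOn ha))
  rintro _ ⟨t, ht, rfl⟩
  exact ⟨hmono ha ht ht.1, hmono ht hb ht.2⟩

theorem Rectifiable.unitSpeed_arcLength (hγ : γ.Rectifiable) {t : ℝ} (ht : t ∈ Icc γ.a γ.b) :
    γ.unitSpeed (γ.arcLength t) = γ.toFun t :=
  edist_eq_zero.1 <| edist_naturalParameterization_eq_zero hγ.locallyBoundedVariationOn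
    (left_mem_Icc.2 γ.a_le_b) ht

theorem Rectifiable.unitSpeed_zero (hγ : γ.Rectifiable) : γ.unitSpeed 0 = γ.source := by
  rw [← γ.arcLength_left, hγ.unitSpeed_arcLength (left_mem_Icc.2 γ.a_le_b), source]

theorem Rectifiable.unitSpeed_length (hγ : γ.Rectifiable) :
    γ.unitSpeed γ.length.toReal = γ.target := by
  rw [← γ.arcLength_right, hγ.unitSpeed_arcLength (right_mem_Icc.2 γ.a_le_b), target]

theorem Rectifiable.lipschitzOnWith_unitSpeed (hγ : γ.Rectifiable) :
    LipschitzOnWith 1 γ.unitSpeed (Icc 0 γ.length.toReal) := by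
  have key : ∀ s ∈ Icc 0 γ.length.toReal, ∀ t ∈ Icc 0 γ.length.toReal, s ≤ t →
      edist (γ.unitSpeed s) (γ.unitSpeed t) ≤ edist s t := by
    intro s hs t ht hst
    have h := has_unit_speed_naturalParameterization γ.toFun hγ.locallyBoundedVariationOn
      (left_mem_Icc.2 γ.a_le_b)
    have himg : variationOnFromTo γ.toFun (Icc γ.a γ.b) γ.a '' Icc γ.a γ.b =
      Icc 0 γ.length.toReal := hγ.arcLength_image
    rw [himg] at h
    have h' := h hs ht
    rw [NNReal.coe_one, one_mul] at h'
    rw [edist_comm s t, edist_dist t s, Real.dist_eq, abs_of_nonneg (sub_nonneg.2 hst), ← h']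
    exact eVariationOn.edist_le _ ⟨hs, le_rfl, hst⟩ ⟨ht, hst, le_rfl⟩
  intro s hs t ht
  rw [ENNReal.coe_one, one_mul]
  rcases le_total s t with hst | hst
  · exact key s hs t ht hst
  · rw [edist_comm, edist_comm s]
    exact key t ht s hs hst

theorem Rectifiable.aemeasurable_comp_unitSpeed [MeasurableSpace Z] [BorelSpace Z]
    (hγ : γ.Rectifiable) {ρ : Z → ℝ≥0∞} (hρ : Measurable ρ) :
    AEMeasurable (fun s => ρ (γ.unitSpeed s)) (volume.restrict (Icc 0 γ.length.toReal)) :=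
  hρ.comp_aemeasurable (hγ.lipschitzOnWith_unitSpeed.continuousOn.aemeasurable measurableSet_Icc)

/-- A curve along which `∞ · 1_N` has finite integral spends no time in `N`. -/
theorem Rectifiable.ae_unitSpeed_notMem [MeasurableSpace Z] [BorelSpace Z] (hγ : γ.Rectifiable)
    {ρ : Z → ℝ≥0∞} (hρ : Measurable ρ) (h : γ.lineIntegral ρ ≠ ∞) {N : Set Z}
    (hN : ∀ z ∈ N, ρ z = ∞) :
    ∀ᵐ s ∂volume.restrict (Icc 0 γ.length.toReal), γ.unitSpeed s ∉ N := by
  filter_upwards [ae_lt_top' (hγ.aemeasurable_comp_unitSpeed hρ) h] with s hs hsN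
  exact hs.ne (hN _ hsN)

theorem lineIntegral_const (hγ : γ.Rectifiable) (L : ℝ≥0∞) :
    γ.lineIntegral (fun _ => L) = L * γ.length := by
  rw [lineIntegral, lintegral_const, Measure.restrict_apply_univ, Real.volume_Icc, sub_zero,
    ENNReal.ofReal_toReal hγ.ne]

theorem edist_source_target_le_length (γ : MetricCurve Z) :
    edist γ.source γ.target ≤ γ.length :=
  eVariationOn.edist_le _ (left_mem_Icc.2 γ.a_le_b) (right_mem_Icc.2 γ.a_le_b)

end MetricCurve

/-! ### Paths avoiding a set -/

/-- `g : [0, T] → Z` is a `1`-Lipschitz path from `p` to `q` which spends no time in `E`. -/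
structure IsAvoidingPath {Z : Type*} [MetricSpace Z] (E : Set Z) (p q : Z) (T : ℝ) (g : ℝ → Z) :
    Prop where
  nonneg : 0 ≤ T
  map_zero : g 0 = p
  map_end : g T = q
  lipschitz : LipschitzOnWith 1 g (Icc 0 T)
  avoids : volume (Icc 0 T ∩ g ⁻¹' E) = 0

namespace IsAvoidingPath

variable {Z : Type*} [MetricSpace Z] {E : Set Z} {p q : Z} {T : ℝ} {g : ℝ → Z}

theorem const (E : Set Z) (p : Z) : IsAvoidingPath E p p 0 fun _ => p where
  nonneg := le_rfl
  map_zero := rfl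
  map_end := rfl
  lipschitz := (LipschitzWith.const' p).lipschitzOnWith
  avoids := measure_mono_null inter_subset_left (by simp)

theorem dist_le (h : IsAvoidingPath E p q T g) : dist p q ≤ T := by
  have := h.lipschitz.dist_le_mul 0 (left_mem_Icc.2 h.nonneg) T (right_mem_Icc.2 h.nonneg)
  rwa [h.map_zero, h.map_end, NNReal.coe_one, one_mul, Real.dist_eq, zero_sub, abs_neg,
    abs_of_nonneg h.nonneg] at this

/-- Slowing down a path. -/
theorem scale (h : IsAvoidingPath E p q T g) {κ : ℝ} (hκ : 1 ≤ κ) :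
    IsAvoidingPath E p q (κ * T) fun t => g (κ⁻¹ * t) := by
  have hκ0 : 0 < κ := by linarith
  have hmaps : ∀ t ∈ Icc 0 (κ * T), κ⁻¹ * t ∈ Icc 0 T := fun t ht =>
    ⟨mul_nonneg (inv_nonneg.2 hκ0.le) ht.1, by rw [inv_mul_le_iff₀ hκ0]; exact ht.2⟩
  refine ⟨mul_nonneg hκ0.le h.nonneg, by simp [h.map_zero], ?_, ?_, ?_⟩
  · simp [inv_mul_cancel_left₀ hκ0.ne', h.map_end]
  · refine LipschitzOnWith.of_dist_le_mul fun s hs t ht => ?_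
    have h1 := h.lipschitz.dist_le_mul _ (hmaps s hs) _ (hmaps t ht)
    rw [NNReal.coe_one, one_mul] at h1 ⊢
    refine h1.trans ?_
    rw [Real.dist_eq, Real.dist_eq, ← mul_sub, abs_mul, abs_of_pos (inv_pos.2 hκ0)]
    exact mul_le_of_le_one_left (abs_nonneg _) (inv_le_one_of_one_le₀ hκ)
  · refine measure_mono_null (t := (fun t => κ⁻¹ * t) ⁻¹' (Icc 0 T ∩ g ⁻¹' E)) ?_ ?_
    · exact fun t ht => ⟨hmaps t ht.1, ht.2⟩
    · rw [Real.volume_preimage_mul_left (inv_ne_zero hκ0.ne'), h.avoids, mul_zero]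

/-- The reversed path. -/
theorem reverse (h : IsAvoidingPath E p q T g) : IsAvoidingPath E q p T fun t => g (T - t) := by
  have hmaps : ∀ t ∈ Icc 0 T, T - t ∈ Icc 0 T := fun t ht =>
    ⟨by linarith [ht.2], by linarith [ht.1]⟩
  refine ⟨h.nonneg, by simp [h.map_end], by simp [h.map_zero], ?_, ?_⟩
  · refine LipschitzOnWith.of_dist_le_mul fun s hs t ht => ?_
    have h1 := h.lipschitz.dist_le_mul _ (hmaps s hs) _ (hmaps t ht)
    rwa [Real.dist_eq, sub_sub_sub_cancel_left, abs_sub_comm, ← Real.dist_eq] at h1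
  · refine measure_mono_null (t := (fun t => T - t) ⁻¹' (Icc 0 T ∩ g ⁻¹' E)) ?_ ?_
    · exact fun t ht => ⟨hmaps t ht.1, ht.2⟩
    · exact (Measure.measurePreserving_sub_left volume T).quasiMeasurePreserving.preimage_null
        h.avoids

/-- A path avoiding `E` is a curve along which functions supported in `E` have zero integral. -/
theorem exists_curve (h : IsAvoidingPath E p q T g) :
    ∃ γ : MetricCurve Z, γ.a = 0 ∧ γ.b = 1 ∧ γ.source = p ∧ γ.target = q ∧
      γ.length ≤ ENNReal.ofReal T ∧
      ∀ ρ : Z → ℝ≥0∞, (∀ z ∉ E, ρ z = 0) → γ.lineIntegral ρ = 0 := by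
  have hmaps : MapsTo (fun t => T * t) (Icc 0 1) (Icc 0 T) := fun t ht =>
    ⟨mul_nonneg h.nonneg ht.1, mul_le_of_le_one_right h.nonneg ht.2⟩
  have hlip : LipschitzOnWith T.toNNReal (fun t => g (T * t)) (Icc 0 1) := by
    refine LipschitzOnWith.of_dist_le_mul fun s hs t ht => ?_
    have h1 := h.lipschitz.dist_le_mul _ (hmaps hs) _ (hmaps ht)
    rwa [NNReal.coe_one, one_mul, Real.dist_eq, ← mul_sub, abs_mul, abs_of_nonneg h.nonneg,
      ← Real.dist_eq, ← congrArg (· * dist s t) (Real.coe_toNNReal T h.nonneg)] at h1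
  let γ : MetricCurve Z := ⟨0, 1, zero_le_one, fun t => g (T * t), hlip.continuousOn⟩
  have hvar : ∀ s ∈ Icc (0 : ℝ) 1, ∀ t ∈ Icc (0 : ℝ) 1, s ≤ t →
      eVariationOn γ.toFun (Icc 0 1 ∩ Icc s t) ≤ ENNReal.ofReal (T * (t - s)) := by
    intro s hs t ht hst
    have h1 := LipschitzOnWith.comp_eVariationOn_le hlip (g := id) (s := Icc s t)
      (fun r hr => ⟨hs.1.trans hr.1, hr.2.trans ht.2⟩)
    rw [eVariationOn_id_Icc] at h1
    rw [ENNReal.ofReal_mul h.nonneg]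
    exact (eVariationOn.mono _ inter_subset_right).trans h1
  have hlen : γ.length ≤ ENNReal.ofReal T := by
    have := hvar 0 (by simp) 1 (by simp) zero_le_one
    rwa [inter_self, sub_zero, mul_one] at this
  have hγ : γ.Rectifiable := hlen.trans_lt ENNReal.ofReal_lt_top
  refine ⟨γ, rfl, rfl, ?_, ?_, hlen, fun ρ hρ => ?_⟩
  · simp [γ, MetricCurve.source, h.map_zero]
  · simp [γ, MetricCurve.target, h.map_end]
  -- Null sets of times must be transferred from `t` to arc length. Arc length is Lipschitz in `t`,
  -- so it maps null sets to null sets; one-dimensional Hausdorff measure expresses this.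
  · have harc : LipschitzOnWith T.toNNReal γ.arcLength (Icc 0 1) := by
      refine LipschitzOnWith.of_le_add_mul _ fun s hs t ht => ?_
      rw [Real.coe_toNNReal T h.nonneg]
      have hmono : MonotoneOn γ.arcLength (Icc 0 1) :=
        variationOnFromTo.monotoneOn hγ.locallyBoundedVariationOn (left_mem_Icc.2 γ.a_le_b)
      rcases le_total s t with hst | hst
      · exact (hmono hs ht hst).trans (le_add_of_nonneg_right (mul_nonneg h.nonneg dist_nonneg))
      · have h1 : γ.arcLength t + variationOnFromTo γ.toFun (Icc 0 1) t s = γ.arcLength s :=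
          variationOnFromTo.add hγ.locallyBoundedVariationOn (left_mem_Icc.2 γ.a_le_b) ht hs
        have h2 : variationOnFromTo γ.toFun (Icc 0 1) t s ≤ T * (s - t) := by
          rw [variationOnFromTo.eq_of_le _ _ hst]
          exact ENNReal.toReal_le_of_le_ofReal (mul_nonneg h.nonneg (sub_nonneg.2 hst))
            (hvar t ht s hs hst)
        rw [Real.dist_eq, abs_of_nonneg (sub_nonneg.2 hst)]
        linarith
    have himg : volume (γ.arcLength '' (Icc 0 1 ∩ γ.toFun ⁻¹' E)) = 0 := by
      have h1 := (harc.mono inter_subset_left).hausdorffMeasure_image_le (d := 1)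
        (s := Icc 0 1 ∩ γ.toFun ⁻¹' E) zero_le_one
      rw [hausdorffMeasure_real] at h1
      refine le_antisymm (h1.trans_eq ?_) zero_le
      rcases h.nonneg.eq_or_lt with hT | hT
      · simp [← hT]
      · refine mul_eq_zero_of_right _
          (measure_mono_null (t := (fun t => T * t) ⁻¹' (Icc 0 T ∩ g ⁻¹' E)) ?_ ?_)
        · exact fun t ht => ⟨hmaps ht.1, ht.2⟩
        · rw [Real.volume_preimage_mul_left hT.ne', h.avoids, mul_zero]
    have hae : (fun s => ρ (γ.unitSpeed s)) =ᵐ[volume.restrict (Icc 0 γ.length.toReal)] 0 := by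
      rw [EventuallyEq, ae_restrict_iff' measurableSet_Icc]
      filter_upwards [measure_eq_zero_iff_ae_notMem.1 himg] with s hs hs'
      rw [← hγ.arcLength_image] at hs'
      obtain ⟨t, ht, rfl⟩ := hs'
      rw [hγ.unitSpeed_arcLength ht]
      exact hρ _ fun htE => hs ⟨t, ⟨ht, htE⟩, rfl⟩
    rw [MetricCurve.lineIntegral, lintegral_congr_ae hae]
    simp

end IsAvoidingPath

/-- The unit speed reparametrization avoids any set of infinite cost. -/
theorem MetricCurve.Rectifiable.isAvoidingPath_unitSpeed {Z : Type*} [MetricSpace Z]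
    [MeasurableSpace Z] [BorelSpace Z] {γ : MetricCurve Z} (hγ : γ.Rectifiable) {ρ : Z → ℝ≥0∞}
    (hρ : Measurable ρ) (h : γ.lineIntegral ρ ≠ ∞) {N : Set Z} (hN : ∀ z ∈ N, ρ z = ∞) :
    IsAvoidingPath N γ.source γ.target γ.length.toReal γ.unitSpeed where
  nonneg := ENNReal.toReal_nonneg
  map_zero := hγ.unitSpeed_zero
  map_end := hγ.unitSpeed_length
  lipschitz := hγ.lipschitzOnWith_unitSpeed
  avoids := by
    have := hγ.ae_unitSpeed_notMem hρ h hN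
    rw [ae_restrict_iff' measurableSet_Icc] at this
    refine measure_mono_null ?_ this
    rintro s ⟨hs, hsN⟩ h'
    exact h' hs hsN

/-! ### Chains of paths and jumps -/

/-- Chains from `p` to `q` consisting of paths avoiding `E` and of allowed jumps. -/
inductive Chain {Z : Type u} [MetricSpace Z] (E : Set Z) (J : Z → Z → Prop) : Z → Z → Type u
  | jump {p q : Z} (h : J p q) : Chain E J p q
  | path {p q : Z} (T : ℝ) (g : ℝ → Z) (h : IsAvoidingPath E p q T g) : Chain E J p q
  | comp {p q r : Z} (A : Chain E J p q) (B : Chain E J q r) : Chain E J p r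

namespace Chain

variable {Z : Type u} [MetricSpace Z] {E : Set Z} {J : Z → Z → Prop} {p q : Z}

/-- The total size of the jumps. -/
noncomputable def jumpSum : {p q : Z} → Chain E J p q → ℝ
  | p, q, jump _ => dist p q
  | _, _, path _ _ _ => 0
  | _, _, comp A B => A.jumpSum + B.jumpSum

/-- The total duration of the paths. -/
def pathTime : {p q : Z} → Chain E J p q → ℝ
  | _, _, jump _ => 0
  | _, _, path T _ _ => T
  | _, _, comp A B => A.pathTime + B.pathTime

/-- The duration of a chain, when a jump takes `Λ` times its size. -/
noncomputable def time (Λ : ℝ) (A : Chain E J p q) : ℝ := A.pathTime + Λ * A.jumpSum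

/-- The parametrization of a chain in which the jump from `p` to `q` is replaced by `F p q`. -/
noncomputable def realize (Λ : ℝ) (F : Z → Z → ℝ → Z) : {p q : Z} → Chain E J p q → ℝ → Z
  | p, q, jump _ => F p q
  | _, _, path _ g _ => g
  | _, _, comp A B => fun t =>
      if t ≤ A.time Λ then A.realize Λ F t else B.realize Λ F (t - A.time Λ)

theorem jumpSum_nonneg (A : Chain E J p q) : 0 ≤ A.jumpSum := by
  induction A with
  | jump h => exact dist_nonneg
  | path T g h => exact le_rfl
  | comp A B hA hB => exact add_nonneg hA hB

theorem pathTime_nonneg (A : Chain E J p q) : 0 ≤ A.pathTime := by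
  induction A with
  | jump h => exact le_rfl
  | path T g h => exact h.nonneg
  | comp A B hA hB => exact add_nonneg hA hB

theorem time_nonneg {Λ : ℝ} (hΛ : 0 ≤ Λ) (A : Chain E J p q) : 0 ≤ A.time Λ :=
  add_nonneg A.pathTime_nonneg (mul_nonneg hΛ A.jumpSum_nonneg)

theorem time_comp {r : Z} (Λ : ℝ) (A : Chain E J p q) (B : Chain E J q r) :
    (A.comp B).time Λ = A.time Λ + B.time Λ := by
  simp only [time, jumpSum, pathTime]
  ring

theorem time_jump (Λ : ℝ) (h : J p q) : (jump (E := E) h).time Λ = Λ * dist p q := by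
  simp [time, jumpSum, pathTime]

theorem time_path (Λ : ℝ) {T : ℝ} {g : ℝ → Z} (h : IsAvoidingPath E p q T g) :
    (path (J := J) T g h).time Λ = T := by
  simp [time, jumpSum, pathTime]

theorem dist_le (A : Chain E J p q) : dist p q ≤ A.pathTime + A.jumpSum := by
  induction A with
  | jump h => simp [jumpSum, pathTime]
  | path T g h => simpa [jumpSum, pathTime] using h.dist_le
  | comp A B hA hB =>
    refine (dist_triangle _ _ _).trans ((add_le_add hA hB).trans_eq ?_)
    simp only [jumpSum, pathTime]
    ring

/-- Slowing down the paths of a chain. -/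
theorem exists_scale {κ : ℝ} (hκ : 1 ≤ κ) (A : Chain E J p q) :
    ∃ B : Chain E J p q, B.pathTime = κ * A.pathTime ∧ B.jumpSum = A.jumpSum := by
  induction A with
  | jump h => exact ⟨jump h, by simp [pathTime], rfl⟩
  | path T g h => exact ⟨path _ _ (h.scale hκ), rfl, rfl⟩
  | comp A B hA hB =>
    obtain ⟨A', hA1, hA2⟩ := hA
    obtain ⟨B', hB1, hB2⟩ := hB
    exact ⟨A'.comp B', by simp only [pathTime, hA1, hB1]; ring, by simp only [jumpSum, hA2, hB2]⟩

end Chain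

/-- `F p q : [0, Λ d(p, q)] → Z` goes from `p` to `q` and is `1`-Lipschitz up to an error of
`ε d(p, q)`, for all allowed jumps from `p` to `q`. -/
structure IsJumpFilling {Z : Type u} [MetricSpace Z] (J : Z → Z → Prop) (Λ ε : ℝ)
    (F : Z → Z → ℝ → Z) : Prop where
  map_zero : ∀ ⦃p q⦄, J p q → F p q 0 = p
  map_end : ∀ ⦃p q⦄, J p q → F p q (Λ * dist p q) = q
  dist_le : ∀ ⦃p q⦄, J p q → ∀ ⦃s t⦄, 0 ≤ s → s ≤ t → t ≤ Λ * dist p q →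
    dist (F p q s) (F p q t) ≤ t - s + ε * dist p q

namespace Chain

variable {Z : Type u} [MetricSpace Z] {E : Set Z} {J : Z → Z → Prop} {p q : Z} {Λ ε : ℝ}
  {F F' : Z → Z → ℝ → Z}

theorem realize_zero (hF : IsJumpFilling J Λ ε F) (hΛ : 0 ≤ Λ) (A : Chain E J p q) :
    A.realize Λ F 0 = p := by
  induction A with
  | jump h => exact hF.map_zero h
  | path T g h => exact h.map_zero
  | comp A B hA hB => simp only [realize, if_pos (A.time_nonneg hΛ), hA]

theorem realize_time (hF : IsJumpFilling J Λ ε F) (hΛ : 0 ≤ Λ) (A : Chain E J p q) :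
    A.realize Λ F (A.time Λ) = q := by
  induction A with
  | jump h => rw [time_jump]; exact hF.map_end h
  | path T g h => rw [time_path]; exact h.map_end
  | comp A B hA hB =>
    rw [time_comp]
    simp only [realize]
    split_ifs with h
    -- At the junction the first part is evaluated, so a second part of duration zero needs its
    -- endpoints to coincide.
    · have hB0 : B.time Λ = 0 := le_antisymm (by linarith) (B.time_nonneg hΛ)
      rw [hB0, realize_zero hF hΛ] at hB
      rw [hB0, add_zero, hA, hB]
    · rw [add_sub_cancel_left, hB]

/-- Paths are exactly `1`-Lipschitz, so only the jumps contribute errors; these add up along the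
chain, the pieces being compared through their common endpoint. -/
theorem dist_realize_le (hF : IsJumpFilling J Λ ε F) (hΛ : 0 ≤ Λ) (hε : 0 ≤ ε)
    (A : Chain E J p q) {s t : ℝ} (hs : 0 ≤ s) (hst : s ≤ t) (ht : t ≤ A.time Λ) :
    dist (A.realize Λ F s) (A.realize Λ F t) ≤ t - s + ε * A.jumpSum := by
  induction A generalizing s t with
  | jump h => rw [time_jump] at ht; exact hF.dist_le h hs hst ht
  | path T g h =>
    rw [time_path] at ht
    have := h.lipschitz.dist_le_mul s ⟨hs, hst.trans ht⟩ t ⟨hs.trans hst, ht⟩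
    rw [NNReal.coe_one, one_mul, dist_comm s, Real.dist_eq, abs_of_nonneg (sub_nonneg.2 hst)]
      at this
    simpa [realize, jumpSum] using this
  | @comp _ r _ A B hA hB =>
    rw [time_comp] at ht
    have hA0 := mul_nonneg hε A.jumpSum_nonneg
    have hB0 := mul_nonneg hε B.jumpSum_nonneg
    simp only [realize, jumpSum, mul_add]
    split_ifs with h1 h2 h2
    · linarith [hA hs hst h2]
    · have h3 := hA hs h1 le_rfl
      have h4 := hB le_rfl (by linarith : 0 ≤ t - A.time Λ) (by linarith)
      rw [realize_time hF hΛ] at h3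
      rw [realize_zero hF hΛ] at h4
      linarith [dist_triangle (A.realize Λ F s) r (B.realize Λ F (t - A.time Λ))]
    · linarith
    · linarith [hB (by linarith : 0 ≤ s - A.time Λ) (by linarith : s - A.time Λ ≤ t - A.time Λ)
        (by linarith)]

/-- Two realizations of one chain agree on its paths and differ only inside its jumps. -/
theorem dist_realize_realize_le {η : ℝ} (hη : 0 ≤ η)
    (h : ∀ ⦃p q⦄, J p q → ∀ t ∈ Icc 0 (Λ * dist p q), dist (F p q t) (F' p q t) ≤ η * dist p q)
    (A : Chain E J p q) {t : ℝ} (ht : t ∈ Icc 0 (A.time Λ)) :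
    dist (A.realize Λ F t) (A.realize Λ F' t) ≤ η * A.jumpSum := by
  induction A generalizing t with
  | jump hJ => rw [time_jump] at ht; exact h hJ t ht
  | path T g h => simp [realize, jumpSum]
  | comp A B hA hB =>
    rw [time_comp] at ht
    have hA0 := mul_nonneg hη A.jumpSum_nonneg
    have hB0 := mul_nonneg hη B.jumpSum_nonneg
    simp only [realize, jumpSum, mul_add]
    split_ifs with h1
    · linarith [hA ⟨ht.1, h1⟩]
    · linarith [hB (t := t - A.time Λ) ⟨by linarith, by linarith [ht.2]⟩]

theorem tendsto_realize {G : ℕ → Z → Z → ℝ → Z}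
    (h : ∀ ⦃p q⦄, J p q → ∀ t ∈ Icc 0 (Λ * dist p q),
      Tendsto (fun n => G n p q t) atTop (𝓝 (F p q t)))
    (A : Chain E J p q) {t : ℝ} (ht : t ∈ Icc 0 (A.time Λ)) :
    Tendsto (fun n => A.realize Λ (G n) t) atTop (𝓝 (A.realize Λ F t)) := by
  induction A generalizing t with
  | jump hJ => rw [time_jump] at ht; exact h hJ t ht
  | path T g h => exact tendsto_const_nhds
  | comp A B hA hB =>
    rw [time_comp] at ht
    simp only [realize]
    split_ifs with h1
    · exact hA ⟨ht.1, h1⟩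
    · exact hB (t := t - A.time Λ) ⟨by linarith, by linarith [ht.2]⟩

/-- Paths spend no time in `E`, so only the fillings of the jumps are charged, and their times add
up by translation invariance. -/
theorem volume_realize_le {β : ℝ} (hβ : 0 ≤ β)
    (h : ∀ ⦃p q⦄, J p q →
      volume (Icc 0 (Λ * dist p q) ∩ F p q ⁻¹' E) ≤ ENNReal.ofReal (β * dist p q))
    (A : Chain E J p q) :
    volume (Icc 0 (A.time Λ) ∩ A.realize Λ F ⁻¹' E) ≤ ENNReal.ofReal (β * A.jumpSum) := by
  induction A with
  | jump hJ => rw [time_jump]; exact h hJ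
  | path T g h => rw [time_path, realize, h.avoids]; exact zero_le
  | comp A B hA hB =>
    have hsub : Icc 0 ((A.comp B).time Λ) ∩ (A.comp B).realize Λ F ⁻¹' E ⊆
        (Icc 0 (A.time Λ) ∩ A.realize Λ F ⁻¹' E) ∪
          (fun t => t - A.time Λ) ⁻¹' (Icc 0 (B.time Λ) ∩ B.realize Λ F ⁻¹' E) := by
      rintro t ⟨ht, htE⟩
      rw [time_comp] at ht
      simp only [mem_preimage, realize] at htE
      split_ifs at htE with h1
      · exact Or.inl ⟨⟨ht.1, h1⟩, htE⟩
      · exact Or.inr ⟨⟨by linarith, by linarith [ht.2]⟩, htE⟩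
    refine (measure_mono hsub).trans ((measure_union_le _ _).trans ?_)
    have hshift : volume ((fun t => t - A.time Λ) ⁻¹' (Icc 0 (B.time Λ) ∩ B.realize Λ F ⁻¹' E)) =
        volume (Icc 0 (B.time Λ) ∩ B.realize Λ F ⁻¹' E) := by
      simp only [sub_eq_add_neg, measure_preimage_add_right]
    rw [hshift, jumpSum, mul_add,
      ENNReal.ofReal_add (mul_nonneg hβ A.jumpSum_nonneg) (mul_nonneg hβ B.jumpSum_nonneg)]
    exact add_le_add hA hB

end Chain

/-! ### Filling the jumps -/

section FillJumps

variable {Z : Type u} [MetricSpace Z] {E : Set Z} {J : Z → Z → Prop} {Λ R : ℝ}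

open Classical in
/-- Iterated filling of the jumps by given chains. -/
noncomputable def fillJumps (Λ : ℝ) (A : ∀ p q : Z, dist p q < R → Chain E J p q) :
    ℕ → Z → Z → ℝ → Z
  | 0, p, q => fun t => if t < Λ * dist p q then p else q
  | n + 1, p, q => if h : dist p q < R then (A p q h).realize Λ (fillJumps Λ A n) else fun _ => p

variable {A : ∀ p q : Z, dist p q < R → Chain E J p q}

/-- The error halves at each level because it is proportional to the total jump size, and a chain
has jumps adding up to at most half the distance it spans. -/
theorem isJumpFilling_fillJumps (hΛ : 0 < Λ) (hJ : ∀ ⦃p q⦄, J p q → dist p q < R)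
    (hA : ∀ p q h, (A p q h).time Λ = Λ * dist p q)
    (hA' : ∀ p q h, (A p q h).jumpSum ≤ dist p q / 2) (n : ℕ) :
    IsJumpFilling J Λ ((1 / 2) ^ n) (fillJumps Λ A n) := by
  induction n with
  | zero =>
    refine ⟨fun p q h => ?_, fun p q h => ?_, fun p q h s t hs hst ht => ?_⟩
    · simp only [fillJumps]
      split_ifs with h0
      · rfl
      · have : Λ * dist p q = 0 := le_antisymm (not_lt.1 h0) (mul_nonneg hΛ.le dist_nonneg)
        exact (dist_eq_zero.1 ((mul_eq_zero.1 this).resolve_left hΛ.ne')).symm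
    · simp [fillJumps]
    · simp only [fillJumps, pow_zero, one_mul]
      have := dist_nonneg (x := p) (y := q)
      split_ifs with h1 h2 h2 <;> simp <;> linarith
  | succ n ih =>
    refine ⟨fun p q h => ?_, fun p q h => ?_, fun p q h s t hs hst ht => ?_⟩
    · rw [fillJumps, dif_pos (hJ h), Chain.realize_zero ih hΛ.le]
    · rw [fillJumps, dif_pos (hJ h), ← hA p q (hJ h), Chain.realize_time ih hΛ.le]
    · rw [← hA p q (hJ h)] at ht
      rw [fillJumps, dif_pos (hJ h)]
      refine (Chain.dist_realize_le ih hΛ.le (by positivity) _ hs hst ht).trans ?_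
      have := mul_le_mul_of_nonneg_left (hA' p q (hJ h)) (by positivity : (0 : ℝ) ≤ (1 / 2) ^ n)
      rw [pow_succ]
      linarith

/-- Self-similarity: levels `n + 1` and `n + 2` realize the same chain, with jumps filled at levels
`n` and `n + 1`, so passing to the next level halves the bound. The constant `2Λ + 2` comes from
level `0`, where both fillings start at `p` and stay within `(Λ + 1) d(p, q)` of it. -/
theorem dist_fillJumps_succ_le (hΛ : 0 < Λ) (hJ : ∀ ⦃p q⦄, J p q → dist p q < R)
    (hA : ∀ p q h, (A p q h).time Λ = Λ * dist p q)
    (hA' : ∀ p q h, (A p q h).jumpSum ≤ dist p q / 2) (n : ℕ) ⦃p q : Z⦄ (h : J p q) :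
    ∀ t ∈ Icc 0 (Λ * dist p q), dist (fillJumps Λ A n p q t) (fillJumps Λ A (n + 1) p q t) ≤
      (2 * Λ + 2) * (1 / 2) ^ n * dist p q := by
  induction n generalizing p q with
  | zero =>
    intro t ht
    have h0 := isJumpFilling_fillJumps hΛ hJ hA hA' 0
    have h1 := isJumpFilling_fillJumps hΛ hJ hA hA' 1
    have h2 := h0.dist_le h le_rfl ht.1 ht.2
    have h3 := h1.dist_le h le_rfl ht.1 ht.2
    rw [h0.map_zero h, pow_zero] at h2
    rw [h1.map_zero h, pow_one] at h3
    have := dist_triangle_left (fillJumps Λ A 0 p q t) (fillJumps Λ A 1 p q t) p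
    have := dist_nonneg (x := p) (y := q)
    simp only [pow_zero, zero_add]
    linarith [ht.2]
  | succ n ih =>
    intro t ht
    rw [← hA p q (hJ h)] at ht
    rw [fillJumps, dif_pos (hJ h), fillJumps, dif_pos (hJ h)]
    refine (Chain.dist_realize_realize_le (by positivity) ih _ ht).trans ?_
    refine (mul_le_mul_of_nonneg_left (hA' p q (hJ h)) (by positivity)).trans_eq ?_
    rw [pow_succ]
    ring

/-- If any two points at distance less than `R` are joined by a chain whose jumps add up to at
most half the distance, then the jumps can be filled, by completeness. -/
theorem exists_isAvoidingPath_of_chains (hΛ : 0 < Λ) (hJ : ∀ ⦃p q⦄, J p q → dist p q < R)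
    (hc : ∀ ⦃p q⦄, J p q → ∃ s, IsComplete s ∧ Metric.closedBall p ((Λ + 1) * dist p q) ⊆ s)
    (hA : ∀ p q h, (A p q h).time Λ = Λ * dist p q)
    (hA' : ∀ p q h, (A p q h).jumpSum ≤ dist p q / 2) {p q : Z} (hpq : dist p q < R) :
    ∃ g, IsAvoidingPath E p q (Λ * dist p q) g := by
  have hfill := isJumpFilling_fillJumps hΛ hJ hA hA'
  have hlim : ∀ p q t, ∃ z, J p q → t ∈ Icc 0 (Λ * dist p q) →
      Tendsto (fun n => fillJumps Λ A n p q t) atTop (𝓝 z) := by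
    intro p q t
    by_cases h : J p q ∧ t ∈ Icc 0 (Λ * dist p q)
    · obtain ⟨h, ht⟩ := h
      obtain ⟨s, hs, hps⟩ := hc h
      have hcauchy : CauchySeq fun n => fillJumps Λ A n p q t := by
        refine cauchySeq_of_le_geometric (1 / 2) ((2 * Λ + 2) * dist p q) (by norm_num) fun n => ?_
        exact (dist_fillJumps_succ_le hΛ hJ hA hA' n h t ht).trans_eq (by ring)
      -- All levels stay in one ball contained in a complete set, so local completeness suffices for
      -- the limit.
      have hmem : ∀ n, fillJumps Λ A n p q t ∈ Metric.closedBall p ((Λ + 1) * dist p q) := by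
        intro n
        have h1 := (hfill n).dist_le h le_rfl ht.1 ht.2
        rw [(hfill n).map_zero h] at h1
        rw [Metric.mem_closedBall, dist_comm]
        have h2 : ((1 : ℝ) / 2) ^ n ≤ 1 := pow_le_one₀ (by norm_num) (by norm_num)
        have h3 := mul_le_mul_of_nonneg_right h2 (dist_nonneg (x := p) (y := q))
        linarith [ht.2]
      obtain ⟨z, -, hz⟩ := cauchySeq_tendsto_of_isComplete hs (fun n => hps (hmem n)) hcauchy
      exact ⟨z, fun _ _ => hz⟩
    · exact ⟨p, fun h1 h2 => absurd ⟨h1, h2⟩ h⟩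
  choose G hG using hlim
  have hGfill : IsJumpFilling J Λ 0 G := by
    refine ⟨fun p q h => ?_, fun p q h => ?_, fun p q h s t hs hst ht => ?_⟩
    · refine tendsto_nhds_unique (hG p q 0 h ⟨le_rfl, by positivity⟩) ?_
      simp only [fun n => (hfill n).map_zero h, tendsto_const_nhds]
    · refine tendsto_nhds_unique (hG p q _ h ⟨by positivity, le_rfl⟩) ?_
      simp only [fun n => (hfill n).map_end h, tendsto_const_nhds]
    · have h1 : Tendsto (fun n : ℕ => t - s + (1 / 2 : ℝ) ^ n * dist p q) atTop
          (𝓝 (t - s + 0 * dist p q)) :=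
        ((tendsto_pow_atTop_nhds_zero_of_lt_one (by norm_num) (by norm_num)).mul_const _).const_add _
      exact le_of_tendsto_of_tendsto' ((hG p q s h ⟨hs, hst.trans ht⟩).dist
        (hG p q t h ⟨hs.trans hst, ht⟩)) h1 fun n => (hfill n).dist_le h hs hst ht
  -- The limit is a fixed point of the filling procedure: `G p q` is the chain from `p` to `q` with
  -- its jumps filled by `G` itself.
  have hGeq : ∀ ⦃p q⦄ (h : J p q), ∀ t ∈ Icc 0 (Λ * dist p q),
      G p q t = (A p q (hJ h)).realize Λ G t := by
    intro p q h t ht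
    refine tendsto_nhds_unique ((hG p q t h ht).comp (tendsto_add_atTop_nat 1)) ?_
    have := Chain.tendsto_realize (fun p q h t ht => hG p q t h ht) (A p q (hJ h))
      (t := t) (by rwa [hA])
    refine this.congr fun n => ?_
    rw [Function.comp_apply, fillJumps, dif_pos (hJ h)]
  -- By the fixed point property, a bound on the time in `E` proportional to the jump size improves
  -- by a factor of two; it starts from the whole duration and tends to zero.
  have hvol : ∀ n : ℕ, ∀ ⦃p q⦄, J p q → volume (Icc 0 (Λ * dist p q) ∩ G p q ⁻¹' E) ≤
      ENNReal.ofReal (Λ * (1 / 2) ^ n * dist p q) := by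
    intro n
    induction n with
    | zero =>
      intro p q h
      refine (measure_mono inter_subset_left).trans_eq ?_
      rw [Real.volume_Icc, sub_zero, pow_zero, mul_one]
    | succ n ih =>
      intro p q h
      have h1 := Chain.volume_realize_le (by positivity) ih (A p q (hJ h))
      rw [hA] at h1
      refine (measure_mono ?_).trans (h1.trans (ENNReal.ofReal_le_ofReal ?_))
      · rintro t ⟨ht, htE⟩
        refine ⟨ht, ?_⟩
        rwa [mem_preimage, ← hGeq h t ht]
      · refine (mul_le_mul_of_nonneg_left (hA' p q (hJ h)) (by positivity)).trans_eq ?_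
        rw [pow_succ]
        ring
  have hvol0 : ∀ ⦃p q⦄, J p q →
      volume (Icc 0 (Λ * dist p q) ∩ G p q ⁻¹' E) ≤ ENNReal.ofReal (0 * dist p q) := by
    intro p q h
    have h1 : Tendsto (fun n : ℕ => ENNReal.ofReal (Λ * (1 / 2 : ℝ) ^ n * dist p q)) atTop
        (𝓝 (ENNReal.ofReal (Λ * 0 * dist p q))) :=
      ENNReal.tendsto_ofReal (((tendsto_pow_atTop_nhds_zero_of_lt_one (by norm_num)
        (by norm_num)).const_mul _).mul_const _)
    rw [mul_zero] at h1
    exact ge_of_tendsto' h1 fun n => hvol n h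
  have hA0 := hA p q hpq
  -- The pair `p, q` need not itself be an allowed jump, so `G` is applied only to the jumps of its
  -- chain.
  refine ⟨(A p q hpq).realize Λ G, by positivity, Chain.realize_zero hGfill hΛ.le _, ?_, ?_, ?_⟩
  · rw [← hA0, Chain.realize_time hGfill hΛ.le]
  · rw [← hA0]
    have key : ∀ s ∈ Icc 0 ((A p q hpq).time Λ), ∀ t ∈ Icc 0 ((A p q hpq).time Λ), s ≤ t →
        dist ((A p q hpq).realize Λ G s) ((A p q hpq).realize Λ G t) ≤ dist s t := by
      intro s hs t ht hst
      have := Chain.dist_realize_le hGfill hΛ.le le_rfl _ hs.1 hst ht.2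
      rwa [zero_mul, add_zero, ← abs_of_nonneg (sub_nonneg.2 hst), ← Real.dist_eq,
        dist_comm t] at this
    refine LipschitzOnWith.of_dist_le_mul fun s hs t ht => ?_
    rw [NNReal.coe_one, one_mul]
    rcases le_total s t with hst | hst
    · exact key s hs t ht hst
    · rw [dist_comm, dist_comm s]
      exact key t ht s hs hst
  · rw [← hA0]
    have := Chain.volume_realize_le le_rfl hvol0 (A p q hpq)
    rw [zero_mul, ENNReal.ofReal_zero] at this
    exact le_antisymm this zero_le

end FillJumps

/-! ### The chain distance -/

section ChainDist

variable {Z : Type u} [MetricSpace Z] {E : Set Z} {J : Z → Z → Prop} {Λ M : ℝ}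

/-- The smallest duration of a chain from `p` to `q`, when a jump takes `Λ` times its size. -/
noncomputable def chainDist (E : Set Z) (J : Z → Z → Prop) (Λ : ℝ) (p q : Z) : ℝ≥0∞ :=
  ⨅ A : Chain E J p q, ENNReal.ofReal (A.time Λ)

/-- The chain distance, truncated at `M`. -/
noncomputable def truncatedChainDist (E : Set Z) (J : Z → Z → Prop) (Λ M : ℝ) (p q : Z) : ℝ :=
  (min (chainDist E J Λ p q) (ENNReal.ofReal M)).toReal

theorem chainDist_le_add (hΛ : 0 ≤ Λ) (x : Z) {p q : Z} (B : Chain E J p q) :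
    chainDist E J Λ x q ≤ chainDist E J Λ x p + ENNReal.ofReal (B.time Λ) := by
  rw [chainDist, chainDist, ENNReal.iInf_add]
  refine le_iInf fun A => (iInf_le _ (A.comp B)).trans_eq ?_
  rw [Chain.time_comp, ENNReal.ofReal_add (A.time_nonneg hΛ) (B.time_nonneg hΛ)]

theorem truncatedChainDist_le_add (hΛ : 0 ≤ Λ) (x : Z) {p q : Z} (B : Chain E J p q) :
    truncatedChainDist E J Λ M x q ≤ truncatedChainDist E J Λ M x p + B.time Λ := by
  have hfin : ∀ a : ℝ≥0∞, min a (ENNReal.ofReal M) ≠ ∞ := fun a =>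
    ((min_le_right _ _).trans_lt ENNReal.ofReal_lt_top).ne
  rw [truncatedChainDist, truncatedChainDist, ← ENNReal.toReal_ofReal (B.time_nonneg hΛ),
    ← ENNReal.toReal_add (hfin _) ENNReal.ofReal_ne_top]
  refine ENNReal.toReal_mono (ENNReal.add_ne_top.2 ⟨hfin _, ENNReal.ofReal_ne_top⟩) ?_
  rw [← min_add_add_right]
  exact min_le_min (chainDist_le_add hΛ x B) le_self_add

theorem truncatedChainDist_self (x : Z) : truncatedChainDist E J Λ M x x = 0 := by
  have : chainDist E J Λ x x = 0 := by
    refine le_antisymm ((iInf_le _ (Chain.path 0 _ (IsAvoidingPath.const E x))).trans_eq ?_) zero_le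
    rw [Chain.time_path, ENNReal.ofReal_zero]
  rw [truncatedChainDist, this, min_eq_left zero_le, ENNReal.toReal_zero]

theorem truncatedChainDist_nonneg (x q : Z) : 0 ≤ truncatedChainDist E J Λ M x q :=
  ENNReal.toReal_nonneg

theorem truncatedChainDist_le (hM : 0 ≤ M) (x q : Z) : truncatedChainDist E J Λ M x q ≤ M :=
  ENNReal.toReal_le_of_le_ofReal hM (min_le_right _ _)

/-- Below the level `M` the truncation is inactive, so the infimum over chains is what is being
bounded. -/
theorem exists_chain_time_lt {x q : Z} {m : ℝ} (hm : truncatedChainDist E J Λ M x q < m)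
    (hM : m ≤ M) : ∃ A : Chain E J x q, A.time Λ < m := by
  have hm0 : 0 < m := (truncatedChainDist_nonneg x q).trans_lt hm
  have h1 : min (chainDist E J Λ x q) (ENNReal.ofReal M) < ENNReal.ofReal m := by
    rwa [ENNReal.lt_ofReal_iff_toReal_lt ((min_le_right _ _).trans_lt ENNReal.ofReal_lt_top).ne]
  have h2 : chainDist E J Λ x q < ENNReal.ofReal m :=
    (min_lt_iff.1 h1).resolve_right (not_lt.2 (ENNReal.ofReal_le_ofReal hM))
  obtain ⟨A, hA⟩ := iInf_lt_iff.1 h2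
  exact ⟨A, (ENNReal.ofReal_lt_ofReal_iff hm0).1 hA⟩

/-- Near `p` one may jump to and from `p`, which changes the value by at most `Λ` times the
distance. -/
theorem continuous_truncatedChainDist (hΛ : 0 ≤ Λ) (hsymm : ∀ p q, J p q → J q p)
    (hloc : ∀ p, ∃ r > 0, ∀ q, dist p q ≤ r → J p q) (x : Z) :
    Continuous (truncatedChainDist E J Λ M x) := by
  refine continuous_iff_continuousAt.2 fun p => ?_
  obtain ⟨r, hr, hJ⟩ := hloc p
  refine tendsto_iff_dist_tendsto_zero.2 ?_
  have h0 : Tendsto (fun q => Λ * dist q p) (𝓝 p) (𝓝 0) := by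
    have : Continuous fun q => Λ * dist q p := by fun_prop
    simpa using this.tendsto p
  refine squeeze_zero' (Eventually.of_forall fun _ => dist_nonneg) ?_ h0
  filter_upwards [Metric.closedBall_mem_nhds p hr] with q hq
  rw [Metric.mem_closedBall, dist_comm] at hq
  have h1 := truncatedChainDist_le_add (E := E) (M := M) hΛ x (Chain.jump (hJ q hq))
  have h2 := truncatedChainDist_le_add (E := E) (M := M) hΛ x (Chain.jump (hsymm _ _ (hJ q hq)))
  rw [Chain.time_jump, dist_comm p q] at h1
  rw [Chain.time_jump] at h2
  rw [Real.dist_eq, abs_le]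
  constructor <;> linarith

/-- A rectifiable curve either has infinite integral, or spends no time in `E`; then its unit speed
parametrization, run in either direction, is an admissible link of duration `ℓ(γ)`. No rectifiable
curve is exceptional. -/
theorem isInftyWeakUpperGradient_truncatedChainDist [MeasurableSpace Z] [BorelSpace Z]
    (μ : Measure Z) (hE : MeasurableSet E) (hΛ : 0 ≤ Λ) (x : Z) :
    IsInftyWeakUpperGradient μ (truncatedChainDist E J Λ M x)
      fun z => 1 + E.indicator (fun _ => ∞) z := by
  have hmeas : Measurable fun z => 1 + E.indicator (fun _ => (∞ : ℝ≥0∞)) z :=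
    (measurable_const.indicator hE).const_add 1
  refine ⟨hmeas, 0, measurable_const, EventuallyEq.rfl, ?_⟩
  rintro γ ⟨-, hγ'⟩ hγ
  refine absurd ?_ hγ'
  by_cases h : γ.lineIntegral (fun z => 1 + E.indicator (fun _ => (∞ : ℝ≥0∞)) z) = ∞
  · rw [h]; exact le_top
  have hpath := hγ.isAvoidingPath_unitSpeed hmeas h (N := E) (by simp +contextual)
  have h1 := truncatedChainDist_le_add (M := M) hΛ x (Chain.path (J := J) _ _ hpath)
  have h2 := truncatedChainDist_le_add (M := M) hΛ x (Chain.path (J := J) _ _ hpath.reverse)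
  rw [Chain.time_path] at h1 h2
  have h3 : γ.length ≤ γ.lineIntegral (fun z => 1 + E.indicator (fun _ => (∞ : ℝ≥0∞)) z) := by
    have := MetricCurve.lineIntegral_const hγ 1
    rw [one_mul] at this
    rw [← this]
    exact lintegral_mono fun s => le_self_add
  refine le_trans ?_ h3
  rw [edist_dist, ← ENNReal.ofReal_toReal hγ.ne]
  refine ENNReal.ofReal_le_ofReal ?_
  rw [Real.dist_eq, abs_le]
  constructor <;> linarith

end ChainDist

/-! ### From Lipschitz estimates to thick quasiconvexity -/

/-- If bounded continuous functions with a weak upper gradient `ρ ≤ 1` are `K`-Lipschitz at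
scale `R`, then the space is very `∞`-thick quasiconvex. -/
theorem veryInftyThickQuasiconvex_of_forall_continuous {Z : Type u} [MetricSpace Z]
    [MeasurableSpace Z] [BorelSpace Z] {μ : Measure Z} (hlc : LocallyComplete Z) {K R M : ℝ}
    (hK : 0 ≤ K) (hR : 0 < R) (hM : (K + 1) * R ≤ M)
    (H : ∀ u : Z → ℝ, Continuous u → (∀ z, 0 ≤ u z ∧ u z ≤ M) →
      (∃ ρ, IsInftyWeakUpperGradient μ u ρ ∧ ρ ≤ᵐ[μ] fun _ => 1) →
      ∀ x y, dist x y < R → |u x - u y| ≤ K * dist x y) :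
    VeryInftyThickQuasiconvex μ (2 * (K + 1)).toNNReal (ENNReal.ofReal (R / 2)) := by
  rintro x₀ x hx y hy ⟨ρ, hρ, hρ0, hinf⟩
  set Λ := 2 * (K + 1) with hΛdef
  have hΛ : 0 < Λ := by positivity
  have hM0 : 0 ≤ M := le_trans (by positivity) hM
  set E : Set Z := {z | ρ z ≠ 0} with hEdef
  have hE : MeasurableSet E := (hρ (measurableSet_singleton 0)).compl
  have hE0 : μ E = 0 := hρ0
  have hh : ∀ p : Z, ∃ r > 0, r < R ∧
      ∃ s, IsComplete s ∧ Metric.closedBall p ((Λ + 2) * r) ⊆ s := by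
    intro p
    obtain ⟨s, hs, hsc⟩ := hlc p
    obtain ⟨ε, hε, hεs⟩ := Metric.nhds_basis_closedBall.mem_iff.1 hs
    refine ⟨min (ε / (Λ + 2)) (R / 2), by positivity,
      (min_le_right _ _).trans_lt (half_lt_self hR), s, hsc,
      (Metric.closedBall_subset_closedBall ?_).trans hεs⟩
    rw [← le_div_iff₀' (by positivity)]
    exact min_le_left _ _
  choose h hpos hlt s hs hsub using hh
  -- A jump must be short relative to the size of a complete ball about one of its ends; allowing
  -- either end makes the relation symmetric. The radius factor `Λ + 2` above leaves room to
  -- recentre from `q` to `p`.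
  let J : Z → Z → Prop := fun p q => dist p q ≤ h p ∨ dist p q ≤ h q
  have hJR : ∀ ⦃p q⦄, J p q → dist p q < R := fun p q hJ =>
    hJ.elim (fun h' => h'.trans_lt (hlt p)) (fun h' => h'.trans_lt (hlt q))
  have hchain : ∀ p q : Z, dist p q < R → ∃ A : Chain E J p q,
      A.time Λ = Λ * dist p q ∧ A.jumpSum ≤ dist p q / 2 := by
    intro p q hpq
    rcases eq_or_ne p q with rfl | hne
    · exact ⟨.path 0 _ (IsAvoidingPath.const E p), by simp [Chain.time_path],
        by simp [Chain.jumpSum]⟩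
    have hd : 0 < dist p q := dist_pos.2 hne
    have h1 := H (truncatedChainDist E J Λ M p)
      (continuous_truncatedChainDist hΛ.le (fun a b hab => by
        rw [dist_comm] at hab
        exact hab.symm) (fun a => ⟨h a, hpos a, fun b hb => Or.inl hb⟩) p)
      (fun z => ⟨truncatedChainDist_nonneg _ _, truncatedChainDist_le hM0 _ _⟩)
      ⟨_, isInftyWeakUpperGradient_truncatedChainDist μ hE hΛ.le p, by
        filter_upwards [measure_eq_zero_iff_ae_notMem.1 hE0] with z hz
        simp [hz]⟩ p q hpq
    rw [truncatedChainDist_self, zero_sub, abs_neg, abs_of_nonneg (truncatedChainDist_nonneg _ _)]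
      at h1
    -- Replacing `K` by `K + 1` makes the bound strict, and `(K + 1) R ≤ M` keeps it below the
    -- truncation.
    obtain ⟨A, hA⟩ := exists_chain_time_lt (m := (K + 1) * dist p q) (h1.trans_lt (by linarith))
      (le_trans (by gcongr) hM)
    have hAd := A.dist_le
    have hAp := A.pathTime_nonneg
    have hAj := A.jumpSum_nonneg
    rw [Chain.time] at hA
    -- The total cost is below `(K + 1) d = Λ d / 2`, and jumps are charged by the factor `Λ`.
    have hj : A.jumpSum ≤ dist p q / 2 := by
      have : Λ * A.jumpSum ≤ Λ * (dist p q / 2) := by rw [hΛdef] at *; linarith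
      exact le_of_mul_le_mul_left this hΛ
    have hp : 0 < A.pathTime := by linarith
    -- Slowing the paths down makes the duration exactly `Λ d(p, q)`, the time slot reserved for a
    -- jump from `p` to `q`.
    obtain ⟨B, hB1, hB2⟩ := A.exists_scale (κ := (Λ * dist p q - Λ * A.jumpSum) / A.pathTime)
      (by rw [one_le_div hp]; rw [hΛdef] at *; nlinarith)
    refine ⟨B, ?_, hB2 ▸ hj⟩
    rw [Chain.time, hB1, hB2, div_mul_cancel₀ _ hp.ne']
    ring
  choose A hA hA' using hchain
  have hxy : dist x y < R := by
    rw [Metric.mem_eball, edist_lt_ofReal] at hx hy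
    linarith [dist_triangle_right x y x₀]
  obtain ⟨g, hg⟩ := exists_isAvoidingPath_of_chains hΛ hJR (fun p q hJ => by
    rcases hJ with hJ | hJ
    · refine ⟨s p, hs p, (Metric.closedBall_subset_closedBall ?_).trans (hsub p)⟩
      gcongr
      linarith
    · refine ⟨s q, hs q, (Metric.closedBall_subset_closedBall' ?_).trans (hsub q)⟩
      calc (Λ + 1) * dist p q + dist p q = (Λ + 2) * dist p q := by ring
        _ ≤ (Λ + 2) * h q := by gcongr) hA hA' hxy
  obtain ⟨γ, ha, hb, hγx, hγy, hlen, hint⟩ := hg.exists_curve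
  have h0 := hint ρ fun z hz => by simpa [hEdef] using hz
  have hmem : γ ∈ quasiconvexCurves x y Λ.toNNReal := by
    refine ⟨ha, hb, hγx, hγy, hlen.trans_eq ?_⟩
    rw [ENNReal.ofReal_mul hΛ.le, edist_dist, ENNReal.ofReal]
  have := hinf γ hmem (hlen.trans_lt ENNReal.ofReal_lt_top)
  rw [h0] at this
  exact ENNReal.zero_ne_top this

/-! ### Averages -/

section Averages

variable {Z : Type u} [MeasurableSpace Z] {μ : Measure Z}

theorem edist_setAverage_le_setLAverage {A : Set Z} (hA0 : μ A ≠ 0) (hAt : μ A ≠ ∞) {u : Z → ℝ}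
    (hu : IntegrableOn u A μ) (b : ℝ) :
    edist (⨍ y in A, u y ∂μ) b ≤ ⨍⁻ y in A, edist (u y) b ∂μ := by
  have : Fact (μ A < ∞) := ⟨hAt.lt_top⟩
  have : NeZero (μ.restrict A) := ⟨by simpa using hA0⟩
  have h1 : ⨍ y in A, u y ∂μ - b = ⨍ y in A, (u y - b) ∂μ := by
    rw [average, average, integral_sub (Integrable.to_average hu) (integrable_const b)]
    exact congrArg _ (average_const (μ.restrict A) b).symm
  rw [edist_eq_enorm_sub, h1]
  simp only [edist_eq_enorm_sub]
  exact enorm_integral_le_lintegral_enorm _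

theorem edist_setAverage_le {A : Set Z} (hA : MeasurableSet A) (hA0 : μ A ≠ 0) (hAt : μ A ≠ ∞)
    {u : Z → ℝ} (hu : IntegrableOn u A μ) {b : ℝ} {m : ℝ≥0∞} (h : ∀ y ∈ A, edist (u y) b ≤ m) :
    edist (⨍ y in A, u y ∂μ) b ≤ m := by
  refine (edist_setAverage_le_setLAverage hA0 hAt hu b).trans ?_
  rw [← setLAverage_const hA0 hAt m, setLAverage_eq, setLAverage_eq]
  gcongr ?_ / _
  exact setLIntegral_mono' hA h

/-- Enlarging the domain of integration from `A` to `B` costs only the ratio of the measures. -/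
theorem edist_setAverage_setAverage_le {A B : Set Z} (hAB : A ⊆ B) (hA0 : μ A ≠ 0) (hBt : μ B ≠ ∞)
    {D : ℝ≥0∞} (hD : μ B ≤ D * μ A) {u : Z → ℝ} (hu : IntegrableOn u A μ) :
    edist (⨍ y in A, u y ∂μ) (⨍ y in B, u y ∂μ) ≤
      D * ⨍⁻ y in B, edist (u y) (⨍ z in B, u z ∂μ) ∂μ := by
  have hAt : μ A ≠ ∞ := measure_ne_top_of_subset hAB hBt
  have hB0 : μ B ≠ 0 := fun h => hA0 (measure_mono_null hAB h)
  refine (edist_setAverage_le_setLAverage hA0 hAt hu _).trans ?_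
  rw [setLAverage_eq, setLAverage_eq]
  set I := ∫⁻ y in B, edist (u y) (⨍ z in B, u z ∂μ) ∂μ
  refine (ENNReal.div_le_div_right (lintegral_mono_set hAB) _).trans ?_
  rw [ENNReal.div_le_iff hA0 hAt]
  calc I = I / μ B * μ B := (ENNReal.div_mul_cancel hB0 hBt).symm
    _ ≤ I / μ B * (D * μ A) := by gcongr
    _ = D * (I / μ B) * μ A := by ring

theorem tendsto_setAverage_ball [MetricSpace Z] [BorelSpace Z] (hμ : FinitePositiveOnBalls μ)
    {u : Z → ℝ} (hu : Continuous u)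
    (hui : ∀ z r, IntegrableOn u (Metric.ball z r) μ) (x : Z) {r : ℕ → ℝ} (hr : ∀ n, 0 < r n)
    (hr0 : Tendsto r atTop (𝓝 0)) :
    Tendsto (fun n => ⨍ y in Metric.ball x (r n), u y ∂μ) atTop (𝓝 (u x)) := by
  refine EMetric.tendsto_nhds.2 fun ε hε => ?_
  obtain ⟨ε', hε', hlt⟩ := exists_between hε
  obtain ⟨δ, hδ, hball⟩ := Metric.mem_nhds_iff.1
    (hu.continuousAt.preimage_mem_nhds (Metric.closedEBall_mem_nhds (u x) hε'))
  filter_upwards [hr0.eventually (gt_mem_nhds hδ)] with n hn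
  refine (edist_setAverage_le measurableSet_ball (hμ x _ (hr n)).1.ne' (hμ x _ (hr n)).2.ne
    (hui _ _) fun y hy => ?_).trans_lt hlt
  exact hball (Metric.ball_subset_ball hn.le hy)

end Averages

/-! ### The telescoping argument -/

/-- Under a doubling condition and a Poincaré inequality, both up to some scale, continuous
functions with a weak upper gradient `ρ ≤ 1` are Lipschitz at a small scale. -/
theorem abs_sub_le_of_doubling_of_poincare {Z : Type u} [MetricSpace Z] [MeasurableSpace Z]
    [BorelSpace Z] {μ : Measure Z} (hμ : FinitePositiveOnBalls μ) {D K τ : ℝ≥0} {r₁ r₂ : ℝ≥0∞}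
    (hD : DoublingUpToScale μ D r₁) (hP : WeakPoincareUpToScale μ K τ r₂) {u : Z → ℝ}
    (hu : Continuous u) {M : ℝ} (hM : ∀ z, 0 ≤ u z ∧ u z ≤ M) {ρ : Z → ℝ≥0∞}
    (hρ : IsInftyWeakUpperGradient μ u ρ) (hρ1 : ρ ≤ᵐ[μ] fun _ => 1) {x w : Z}
    (h₁ : ENNReal.ofReal (2 * dist x w) < r₁) (h₂ : ENNReal.ofReal (2 * dist x w) ≤ r₂) :
    |u x - u w| ≤ (12 * D * K + 4 * D ^ 2 * K) * dist x w := by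
  rcases eq_or_ne x w with rfl | hne
  · simp
  set d := dist x w with hd
  have hd0 : 0 < d := dist_pos.2 hne
  have hint : ∀ s : Set Z, Bornology.IsBounded s → IntegrableOn u s μ := by
    intro s hs
    obtain ⟨r, hr⟩ := (Metric.isBounded_iff_subset_ball x).1 hs
    have hfin : μ s ≠ ∞ := by
      refine measure_ne_top_of_subset (hr.trans (Metric.ball_subset_ball (le_max_left r 1))) ?_
      exact (hμ x _ (lt_max_of_lt_right one_pos)).2.ne
    refine Measure.integrableOn_of_bounded hfin hu.aestronglyMeasurable (M := M)
      (Eventually.of_forall fun z => ?_)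
    rw [Real.norm_eq_abs, abs_of_nonneg (hM z).1]
    exact (hM z).2
  have hui : ∀ z r, IntegrableOn u (Metric.ball z r) μ := fun z r => hint _ Metric.isBounded_ball
  have hosc : ∀ z r, 0 < r → r ≤ 2 * d →
      (⨍⁻ y in Metric.ball z r, edist (u y) (⨍ y' in Metric.ball z r, u y' ∂μ) ∂μ) ≤
        ENNReal.ofReal (2 * K * r) := by
    intro z r hr hrd
    refine (hP z r hr ((ENNReal.ofReal_le_ofReal hrd).trans h₂) u hint ρ hρ).trans ?_
    have hess : essSup ρ (μ.restrict (Metric.ball z (τ * r))) ≤ 1 :=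
      essSup_le_of_ae_le _ (ae_restrict_of_ae hρ1)
    have hdiam : Metric.ediam (Metric.ball z r) ≤ ENNReal.ofReal (2 * r) := by
      rw [← Metric.eball_ofReal, ENNReal.ofReal_mul zero_le_two, ENNReal.ofReal_ofNat]
      exact Metric.ediam_eball_le
    calc _ ≤ (K : ℝ≥0∞) * ENNReal.ofReal (2 * r) * 1 := by gcongr
      _ = ENNReal.ofReal (2 * K * r) := by
        rw [mul_one, ← ENNReal.ofReal_coe_nnreal, ← ENNReal.ofReal_mul K.coe_nonneg]
        congr 1
        ring
  have hcomp : ∀ (z z' : Z) (r r' : ℝ) (m : ℝ≥0), 0 < r → 0 < r' → r' ≤ 2 * d →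
      Metric.ball z r ⊆ Metric.ball z' r' →
      μ (Metric.ball z' r') ≤ m * μ (Metric.ball z r) →
      dist (⨍ y in Metric.ball z r, u y ∂μ) (⨍ y in Metric.ball z' r', u y ∂μ) ≤
        m * (2 * K * r') := by
    intro z z' r r' m hr hr' hrd hsub hm
    have h1 := edist_setAverage_setAverage_le hsub (hμ z r hr).1.ne' (hμ z' r' hr').2.ne hm (hui z r)
    have h2 := h1.trans (mul_le_mul_right (hosc z' r' hr' hrd) _)
    rw [← ENNReal.ofReal_coe_nnreal, ← ENNReal.ofReal_mul m.coe_nonneg] at h2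
    rw [← edist_le_ofReal (by positivity)]
    exact h2
  have htele : ∀ z r, 0 < r → r ≤ 2 * d →
      dist (⨍ y in Metric.ball z r, u y ∂μ) (u z) ≤ 4 * D * K * r := by
    intro z r hr hrd
    have hpos : ∀ n : ℕ, 0 < r / 2 ^ n := fun n => by positivity
    have hlim : Tendsto (fun n : ℕ => r / 2 ^ n) atTop (𝓝 0) := by
      have := (tendsto_pow_atTop_nhds_zero_of_lt_one (r := (1 / 2 : ℝ)) (by norm_num)
        (by norm_num)).const_mul r
      rw [mul_zero] at this
      refine this.congr fun n => ?_
      rw [one_div, inv_pow, div_eq_mul_inv]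
    -- Averages over the balls of radii `r / 2^n` and `r / 2^(n+1)` differ by at most `2DKr / 2^n`,
    -- which sums to `4DKr`.
    have h := dist_le_of_le_geometric_two_of_tendsto₀ (C := 4 * D * K * r)
      (f := fun n => ⨍ y in Metric.ball z (r / 2 ^ n), u y ∂μ) (fun n => ?_)
      (tendsto_setAverage_ball hμ hu hui z hpos hlim)
    · simpa using h
    · have hle : r / 2 ^ n ≤ r := div_le_self hr.le (one_le_pow₀ one_le_two)
      have heq : 2 * (r / 2 ^ (n + 1)) = r / 2 ^ n := by
        rw [pow_succ]
        field_simp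
      have hlt : r / 2 ^ (n + 1) ≤ 2 * d := by linarith [hpos (n + 1)]
      rw [dist_comm]
      refine (hcomp z z _ _ D (hpos (n + 1)) (hpos n) (hle.trans hrd)
        (Metric.ball_subset_ball (by linarith [hpos (n + 1)])) ?_).trans_eq ?_
      · have := hD z (r / 2 ^ (n + 1)) (hpos _)
          ((ENNReal.ofReal_le_ofReal hlt).trans_lt h₁)
        rwa [heq] at this
      · field_simp
        ring
  have h1 := htele x (2 * d) (by positivity) le_rfl
  have h2 := htele w d hd0 (by linarith)
  -- Since `B(w, d) ⊆ B(x, 2d) ⊆ B(w, 4d)`, two doublings compare the balls. The three errors are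
  -- `8DKd`, `4D²Kd` and `4DKd`.
  have h3 := hcomp w x d (2 * d) (D ^ 2) hd0 (by positivity) le_rfl
    (Metric.ball_subset_ball' (by rw [dist_comm w x]; linarith)) (by
      have e1 := hD w d hd0 ((ENNReal.ofReal_le_ofReal (by linarith)).trans_lt h₁)
      have e2 := hD w (2 * d) (by positivity) h₁
      have e3 : μ (Metric.ball x (2 * d)) ≤ μ (Metric.ball w (2 * (2 * d))) :=
        measure_mono (Metric.ball_subset_ball' (by linarith))
      calc _ ≤ _ := e3
        _ ≤ _ := e2
        _ ≤ D * (D * μ (Metric.ball w d)) := by gcongr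
        _ = _ := by push_cast; ring)
  rw [← Real.dist_eq]
  have t1 := dist_triangle4 (u x) (⨍ y in Metric.ball x (2 * d), u y ∂μ)
    (⨍ y in Metric.ball w d, u y ∂μ) (u w)
  rw [dist_comm (u x) (⨍ y in _, u y ∂μ),
    dist_comm (⨍ y in Metric.ball x (2 * d), u y ∂μ) (⨍ y in _, u y ∂μ)] at t1
  push_cast at h3
  nlinarith

/-! ### Consequences of thick quasiconvexity -/

/-- If the quasiconvex curves from `y` to `z` are not negligible, then a weak upper gradient of `u`
controls the difference of `u` at `y` and `z`. -/
theorem edist_le_of_not_inftyNegligible {Z : Type u} [MetricSpace Z] [MeasurableSpace Z]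
    [BorelSpace Z] {μ : Measure Z} {C : ℝ≥0} {y z : Z}
    (h : ¬ InftyNegligible μ (quasiconvexCurves y z C)) {S : Set Z} (hS : MeasurableSet S)
    (hyS : ∀ w, edist y w ≤ C * edist y z → w ∈ S) {v : Z → ℝ} {ρ : Z → ℝ≥0∞}
    (hρ : IsInftyWeakUpperGradient μ v ρ) :
    edist (v y) (v z) ≤ C * edist y z * essSup ρ (μ.restrict S) := by
  rcases eq_or_ne y z with rfl | hne
  · simp
  by_contra hcon
  refine h ?_
  set L := essSup ρ (μ.restrict S) with hL
  obtain ⟨hρm, ρ₀, hρ₀m, hρ₀, hinf⟩ := hρ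
  have hN : MeasurableSet (S ∩ {w | L < ρ w}) := hS.inter (measurableSet_lt measurable_const hρm)
  have hN0 : μ (S ∩ {w | L < ρ w}) = 0 := by
    have : (μ.restrict S) {w | L < ρ w} = 0 := meas_essSup_lt
    rwa [Measure.restrict_apply (measurableSet_lt measurable_const hρm), inter_comm] at this
  -- If the estimate failed, this a.e. vanishing function would make the quasiconvex curves
  -- negligible: finite integral forces the upper gradient inequality and `ρ ≤ L` at almost every
  -- time spent in `S`.
  have hm : Measurable fun w => ρ₀ w + (S ∩ {w | L < ρ w}).indicator (fun _ => ∞) w :=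
    hρ₀m.add (measurable_const.indicator hN)
  refine ⟨_, hm, ?_, ?_⟩
  · filter_upwards [hρ₀, measure_eq_zero_iff_ae_notMem.1 hN0] with w hw hwN
    simp [hw, indicator_of_notMem hwN]
  · rintro γ ⟨-, -, hγy, hγz, hlen⟩ hγ
    by_contra hfin
    have hgood : edist (v y) (v z) ≤ γ.lineIntegral ρ := by
      by_contra hbad
      refine hfin (top_le_iff.1 ?_)
      rw [← hinf γ ⟨fun hconst => hne ?_, by rwa [hγy, hγz]⟩ hγ]
      · exact lintegral_mono fun s => le_self_add
      · rw [← hγy, ← hγz]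
        exact (hconst γ.b (right_mem_Icc.2 γ.a_le_b)).symm
    refine hcon (hgood.trans ?_)
    calc γ.lineIntegral ρ ≤ γ.lineIntegral fun _ => L := by
          refine lintegral_mono_ae ?_
          have hae := hγ.ae_unitSpeed_notMem hm hfin (N := S ∩ {w | L < ρ w}) (by
            intro w hw
            simp [indicator_of_mem hw])
          filter_upwards [hae, ae_restrict_mem measurableSet_Icc] with s hs hs'
          -- The whole curve lies in `S`, since its points are within its length of `y`.
          refine not_lt.1 fun hlt => hs ⟨hyS _ ?_, hlt⟩
          have h1 := hγ.lipschitzOnWith_unitSpeed (left_mem_Icc.2 ENNReal.toReal_nonneg) hs'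
          rw [hγ.unitSpeed_zero, hγy, ENNReal.coe_one, one_mul] at h1
          refine h1.trans (le_trans ?_ hlen)
          rw [edist_dist, Real.dist_eq, zero_sub, abs_neg, abs_of_nonneg hs'.1]
          exact ENNReal.ofReal_le_of_le_toReal hs'.2
      _ = L * γ.length := MetricCurve.lineIntegral_const hγ L
      _ ≤ L * (C * edist y z) := by gcongr
      _ = C * edist y z * L := mul_comm _ _

/-- Thick quasiconvexity implies a Poincaré inequality. -/
theorem VeryInftyThickQuasiconvex.weakPoincareUpToScale {Z : Type u} [MetricSpace Z]
    [MeasurableSpace Z] [BorelSpace Z] {μ : Measure Z} (hμ : FinitePositiveOnBalls μ) {C : ℝ≥0}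
    {R : ℝ≥0∞} (h : VeryInftyThickQuasiconvex μ C R) :
    WeakPoincareUpToScale μ C (1 + 2 * C) R := by
  intro x r hr hrR v hv ρ hρ
  set L := essSup ρ (μ.restrict (Metric.ball x (↑(1 + 2 * C) * r)))
  have hpair : ∀ y ∈ Metric.ball x r, ∀ z ∈ Metric.ball x r,
      edist (v y) (v z) ≤ C * Metric.ediam (Metric.ball x r) * L := by
    intro y hy z hz
    have hR : ∀ w ∈ Metric.ball x r, w ∈ Metric.eball x R := fun w hw =>
      Metric.eball_subset_eball hrR (by rwa [Metric.eball_ofReal])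
    refine (edist_le_of_not_inftyNegligible (h x y (hR y hy) z (hR z hz))
      (S := Metric.ball x (↑(1 + 2 * C) * r)) measurableSet_ball (fun w hw => ?_) hρ).trans ?_
    -- The dilation `1 + 2C`: a point of the curve is within `C d(y, z) ≤ 2Cr` of `y`, and `y` is
    -- within `r` of the centre.
    · rw [Metric.mem_ball] at hy hz ⊢
      have h1 : dist y w ≤ C * dist y z := by
        rwa [edist_dist, edist_dist, ← ENNReal.ofReal_coe_nnreal, ← ENNReal.ofReal_mul C.coe_nonneg,
          ENNReal.ofReal_le_ofReal_iff (by positivity)] at hw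
      have h2 : (C : ℝ) * dist y z ≤ C * (2 * r) := by
        gcongr
        linarith [dist_triangle_right y z x]
      push_cast
      linarith [dist_triangle_left w x y]
    · gcongr
      exact Metric.edist_le_ediam_of_mem hy hz
  have h0 := (hμ x r hr).1.ne'
  have ht := (hμ x r hr).2.ne
  have hav : ∀ y ∈ Metric.ball x r, edist (v y) (⨍ z in Metric.ball x r, v z ∂μ) ≤
      C * Metric.ediam (Metric.ball x r) * L := by
    intro y hy
    rw [edist_comm]
    exact edist_setAverage_le measurableSet_ball h0 ht (hv _ Metric.isBounded_ball)
      fun z hz => hpair z hz y hy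
  rw [← setLAverage_const h0 ht (C * Metric.ediam (Metric.ball x r) * L), setLAverage_eq,
    setLAverage_eq]
  gcongr ?_ / _
  exact setLIntegral_mono' measurableSet_ball hav

theorem FinitePositiveOnBalls.isOpenPosMeasure {Z : Type u} [MetricSpace Z] [MeasurableSpace Z]
    {μ : Measure Z} (hμ : FinitePositiveOnBalls μ) : μ.IsOpenPosMeasure := by
  refine ⟨fun U hU ⟨x, hx⟩ h0 => ?_⟩
  obtain ⟨r, hr, hrU⟩ := Metric.isOpen_iff.1 hU x hx
  exact (hμ x r hr).1.ne' (measure_mono_null hrU h0)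

/-- The Lipschitz constant is an `∞`-weak upper gradient. -/
theorem LipschitzWith.isInftyWeakUpperGradient {Z : Type u} [MetricSpace Z] [MeasurableSpace Z]
    (μ : Measure Z) {f : Z → ℝ} {K : ℝ≥0} (hf : LipschitzWith K f) :
    IsInftyWeakUpperGradient μ f fun _ => K := by
  refine ⟨measurable_const, 0, measurable_const, EventuallyEq.rfl, ?_⟩
  rintro γ ⟨-, hγ'⟩ hγ
  refine absurd ?_ hγ'
  rw [MetricCurve.lineIntegral_const hγ]
  exact (hf _ _).trans (by gcongr; exact γ.edist_source_target_le_length)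

theorem LipschitzWith.lipConst_le {Z : Type u} [MetricSpace Z] {f : Z → ℝ} {K : ℝ≥0}
    (hf : LipschitzWith K f) : lipConst f ≤ K :=
  iInf₂_le K hf

theorem lipSpace_subset_sobolevSpace {Z : Type u} [MetricSpace Z] [MeasurableSpace Z]
    (μ : Measure Z) : lipSpace μ ⊆ sobolevSpace μ := by
  rintro v ⟨f, ⟨K, hK⟩, hf⟩
  refine ⟨f, ⟨(Lp.memLp v).ae_eq hf, fun _ => K, hK.isInftyWeakUpperGradient μ, ?_⟩, hf⟩
  exact (essSup_le_of_ae_le _ EventuallyLE.rfl).trans_lt ENNReal.coe_lt_top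

/-- A Newton--Sobolev function on a thick quasiconvex space is Lipschitz. -/
theorem VeryInftyThickQuasiconvex.lipschitzWith {Z : Type u} [MetricSpace Z]
    [MeasurableSpace Z] [BorelSpace Z] {μ : Measure Z} (hμ : FinitePositiveOnBalls μ) {C r : ℝ≥0}
    (hr : 0 < r) (h : VeryInftyThickQuasiconvex μ C r) {v : Z → ℝ} (hv : MemLp v ∞ μ)
    {ρ : Z → ℝ≥0∞} (hρ : ρ ∈ boundedWeakUpperGradients μ v) :
    LipschitzWith (C * (essSup ρ μ).toNNReal + 2 * (eLpNorm v ∞ μ).toNNReal / r) v := by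
  have := hμ.isOpenPosMeasure
  set L := (essSup ρ μ).toNNReal with hL
  set a := (eLpNorm v ∞ μ).toNNReal with ha
  have hL' : essSup ρ μ = L := (ENNReal.coe_toNNReal hρ.2.ne).symm
  have ha' : eLpNorm v ∞ μ = a := (ENNReal.coe_toNNReal hv.2.ne).symm
  have hloc : ∀ x y, edist x y < r → edist (v x) (v y) ≤ (C * L : ℝ≥0) * edist x y := by
    intro x y hxy
    have h1 := edist_le_of_not_inftyNegligible
      (h x x (Metric.mem_eball_self (by simpa using hr)) y (by rwa [Metric.mem_eball']))
      MeasurableSet.univ (fun _ _ => mem_univ _) hρ.1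
    rw [Measure.restrict_univ, hL'] at h1
    refine h1.trans_eq ?_
    push_cast
    ring
  have hcont : Continuous v := by
    refine continuous_iff_continuousAt.2 fun x => ?_
    have : LipschitzOnWith (C * L) v (Metric.eball x (r / 2)) := by
      intro y hy z hz
      refine hloc y z ?_
      rw [Metric.mem_eball] at hy
      rw [Metric.mem_eball'] at hz
      exact (edist_triangle y x z).trans_lt ((ENNReal.add_lt_add hy hz).trans_eq
        (ENNReal.add_halves _))
    exact this.continuousOn.continuousAt (Metric.eball_mem_nhds x (by simpa using hr.ne'))
  -- A set of full measure is dense, so continuity turns the essential bound into a pointwise one.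
  have hbound : ∀ x, edist (v x) 0 ≤ a := by
    have hae : ∀ᵐ x ∂μ, edist (v x) 0 ≤ a := by
      filter_upwards [ae_le_eLpNormEssSup (f := v) (μ := μ)] with x hx
      rwa [edist_zero_right, ← ha', eLpNorm_exponent_top]
    have hclosed : IsClosed {x | edist (v x) 0 ≤ a} :=
      isClosed_le (by fun_prop) continuous_const
    have hdense := Measure.dense_of_ae hae
    intro x
    have := hdense x
    rwa [hclosed.closure_eq] at this
  intro x y
  rcases lt_or_ge (edist x y) r with hxy | hxy
  · refine (hloc x y hxy).trans ?_
    gcongr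
    exact le_self_add
  -- For points at distance at least `r`, the sup bound alone gives the Lipschitz constant `2a / r`.
  · calc edist (v x) (v y) ≤ edist (v x) 0 + edist (v y) 0 := edist_triangle_right _ _ _
      _ ≤ a + a := add_le_add (hbound x) (hbound y)
      _ = ((2 * a / r : ℝ≥0) : ℝ≥0∞) * r := by
        rw [← ENNReal.coe_mul, div_mul_cancel₀ _ hr.ne', ← ENNReal.coe_add, two_mul]
      _ ≤ _ := by
        gcongr
        exact le_add_self

/-- Thick quasiconvexity implies that Newton--Sobolev functions are Lipschitz. -/
theorem VeryInftyThickQuasiconvex.lipEqSobolev {Z : Type u} [MetricSpace Z]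
    [MeasurableSpace Z] [BorelSpace Z] {μ : Measure Z} (hμ : FinitePositiveOnBalls μ) {C r : ℝ≥0}
    (hr : 0 < r) (h : VeryInftyThickQuasiconvex μ C r) :
    LipEqSobolev μ (1 + C + 2 / r)⁻¹ := by
  refine ⟨(lipSpace_subset_sobolevSpace μ).antisymm ?_, fun w _ => ?_⟩
  · rintro w ⟨v, ⟨hv, ρ, hρ⟩, hwv⟩
    exact ⟨v, ⟨_, h.lipschitzWith hμ hr hv hρ⟩, hwv⟩
  · refine le_iInf₂ fun v ⟨hv, hwv⟩ => ?_
    rw [newtonNorm, ← tsub_le_iff_left]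
    refine le_iInf₂ fun ρ hρ => ?_
    rw [tsub_le_iff_left]
    have hlip := h.lipschitzWith hμ hr hv.1 hρ
    have h1 : lipNorm μ w ≤ eLpNorm v ∞ μ + lipConst v := iInf₂_le v ⟨⟨_, hlip⟩, hwv⟩
    have h2 := hlip.lipConst_le
    rw [← ENNReal.coe_toNNReal hv.1.2.ne] at h1 ⊢
    rw [← ENNReal.coe_toNNReal hρ.2.ne]
    set L := (essSup ρ μ).toNNReal
    set a := (eLpNorm v ∞ μ).toNNReal
    have h3 : lipNorm μ w ≤ ((a + (C * L + 2 * a / r) : ℝ≥0) : ℝ≥0∞) := by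
      rw [ENNReal.coe_add]
      exact h1.trans (by gcongr)
    refine (mul_le_mul_right h3 _).trans ?_
    rw [← ENNReal.coe_mul, ← ENNReal.coe_add, ENNReal.coe_le_coe, inv_mul_le_iff₀ (by positivity)]
    -- The added cross terms make the sum factor as a multiple of the Sobolev norm bound `a + L`.
    calc a + (C * L + 2 * a / r) ≤ a + (C * L + 2 * a / r) + (L + C * a + 2 * L / r) := le_self_add
      _ = (1 + C + 2 / r) * (a + L) := by ring

/-! ### Spaces on which Newton--Sobolev functions are Lipschitz -/

/-- The Sobolev norm is at most `2`, so the Lipschitz norm is at most `2 / c`. Since balls have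
positive measure, a Lipschitz representative equals the continuous function `v` everywhere. The
extra `1` gives the strict inequality needed to choose a competitor in the infima. -/
theorem LipEqSobolev.abs_sub_le {Z : Type u} [MetricSpace Z] [MeasurableSpace Z] [BorelSpace Z]
    {μ : Measure Z} (hμ : FinitePositiveOnBalls μ) {c : ℝ≥0} (hc : 0 < c) (h : LipEqSobolev μ c)
    {v : Z → ℝ} (hv : Continuous v) (hv1 : ∀ z, 0 ≤ v z ∧ v z ≤ 1) {ρ : Z → ℝ≥0∞}
    (hρ : IsInftyWeakUpperGradient μ v ρ) (hρ1 : ρ ≤ᵐ[μ] fun _ => 1) (x y : Z) :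
    |v x - v y| ≤ (2 / c + 1) * dist x y := by
  have := hμ.isOpenPosMeasure
  have hess : essSup ρ μ ≤ 1 := essSup_le_of_ae_le _ hρ1
  have hb : ∀ᵐ z ∂μ, ‖v z‖ ≤ 1 := Eventually.of_forall fun z => by
    rw [Real.norm_eq_abs, abs_of_nonneg (hv1 z).1]
    exact (hv1 z).2
  have hmem : MemLp v ∞ μ := memLp_top_of_bound hv.aestronglyMeasurable 1 hb
  have hρ' : ρ ∈ boundedWeakUpperGradients μ v := ⟨hρ, hess.trans_lt ENNReal.one_lt_top⟩
  have hN : v ∈ newtonFunctions μ := ⟨hmem, ρ, hρ'⟩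
  have hS : hmem.toLp v ∈ sobolevSpace μ := ⟨v, hN, hmem.coeFn_toLp⟩
  have h1 : sobolevNorm μ (hmem.toLp v) ≤ 1 + 1 := by
    refine (iInf₂_le v ⟨hN, hmem.coeFn_toLp⟩).trans (add_le_add ?_ ((iInf₂_le ρ hρ').trans hess))
    rw [eLpNorm_exponent_top]
    refine (eLpNormEssSup_le_of_ae_bound hb).trans_eq ENNReal.ofReal_one
  have h2 : lipNorm μ (hmem.toLp v) < ((2 / c + 1 : ℝ≥0) : ℝ≥0∞) := by
    have h3 := (h.2 _ hS).trans h1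
    have hc' : (c : ℝ≥0∞) ≠ 0 := by simpa using hc.ne'
    rw [one_add_one_eq_two, mul_comm, ← ENNReal.le_div_iff_mul_le (Or.inl hc') (Or.inl (by simp))]
      at h3
    refine h3.trans_lt ?_
    rw [ENNReal.coe_add, ENNReal.coe_div hc.ne']
    exact ENNReal.lt_add_right (ENNReal.div_lt_top (by simp) hc').ne (by simp)
  obtain ⟨f, h4⟩ := iInf_lt_iff.1 h2
  obtain ⟨⟨⟨K, hK⟩, hf⟩, hlt⟩ := iInf_lt_iff.1 h4
  obtain ⟨K', h5⟩ := iInf_lt_iff.1 (le_add_self.trans_lt hlt)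
  obtain ⟨hK', hlt'⟩ := iInf_lt_iff.1 h5
  have hfv : f = v := (Continuous.ae_eq_iff_eq μ hK.continuous hv).1
    (hf.symm.trans hmem.coeFn_toLp)
  rw [hfv] at hK'
  have h6 := hK'.dist_le_mul x y
  rw [Real.dist_eq] at h6
  refine h6.trans (mul_le_mul_of_nonneg_right ?_ dist_nonneg)
  exact_mod_cast (ENNReal.coe_lt_coe.1 hlt').le

theorem VeryInftyThickQuasiconvex.mono {Z : Type u} [MetricSpace Z] [MeasurableSpace Z]
    {μ : Measure Z} {C : ℝ≥0} {R R' : ℝ≥0∞} (hR : R' ≤ R) (h : VeryInftyThickQuasiconvex μ C R) :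
    VeryInftyThickQuasiconvex μ C R' := fun x₀ x hx y hy =>
  h x₀ x (Metric.eball_subset_eball hR hx) y (Metric.eball_subset_eball hR hy)

theorem LipEqSobolev.veryInftyThickQuasiconvex {Z : Type u} [MetricSpace Z] [MeasurableSpace Z]
    [BorelSpace Z] {μ : Measure Z} (hμ : StandingAssumptions μ) {c : ℝ≥0} (hc : 0 < c)
    (h : LipEqSobolev μ c) :
    VeryInftyThickQuasiconvex μ (2 * ((2 / c + 1 : ℝ) + 1)).toNNReal
      (ENNReal.ofReal ((2 / c + 1 + 1 : ℝ)⁻¹ / 2)) := by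
  -- The functions are normalized to take values in `[0, 1]`, so the scale is chosen as `1 / (K +
  -- 1)` to satisfy the truncation condition with `M = 1`.
  have hK : (0 : ℝ) ≤ 2 / c + 1 := by positivity
  refine veryInftyThickQuasiconvex_of_forall_continuous hμ.locallyComplete hK (by positivity)
    (mul_inv_cancel₀ (by positivity)).le ?_
  rintro v hv hv1 ⟨ρ, hρ, hρ1⟩ x y -
  exact h.abs_sub_le hμ.finitePositiveOnBalls hc hv hv1 hρ hρ1 x y

theorem exists_pos_nnreal_le {r : ℝ≥0∞} (hr : 0 < r) : ∃ s : ℝ≥0, 0 < s ∧ (s : ℝ≥0∞) ≤ r := by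
  obtain ⟨s, hs, hsr⟩ := ENNReal.lt_iff_exists_nnreal_btwn.1 hr
  exact ⟨s, by exact_mod_cast hs, hsr.le⟩

/-! ### The main theorem: choice of constants -/

theorem mainTheorem1 :
    -- (1) implies (2), quantitatively
    (∀ c : ℝ≥0, 0 < c → ∃ (C : ℝ≥0) (R : ℝ≥0∞), 1 ≤ C ∧ 0 < R ∧
      ∀ (Z : Type u) [MetricSpace Z] [TopologicalSpace.SeparableSpace Z]
        [MeasurableSpace Z] [BorelSpace Z] (μ : Measure Z), StandingAssumptions μ →
        LipEqSobolev μ c → VeryInftyThickQuasiconvex μ C R) ∧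
    -- (2) implies (1), quantitatively
    (∀ (C : ℝ≥0) (R : ℝ≥0∞), 1 ≤ C → 0 < R → ∃ c : ℝ≥0, 0 < c ∧
      ∀ (Z : Type u) [MetricSpace Z] [TopologicalSpace.SeparableSpace Z]
        [MeasurableSpace Z] [BorelSpace Z] (μ : Measure Z), StandingAssumptions μ →
        VeryInftyThickQuasiconvex μ C R → LipEqSobolev μ c) ∧
    -- (1) implies a weak Poincaré inequality up to some scale, quantitatively
    (∀ c : ℝ≥0, 0 < c → ∃ (K τ : ℝ≥0) (r : ℝ≥0∞), 0 < K ∧ 1 ≤ τ ∧ 0 < r ∧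
      ∀ (Z : Type u) [MetricSpace Z] [TopologicalSpace.SeparableSpace Z]
        [MeasurableSpace Z] [BorelSpace Z] (μ : Measure Z), StandingAssumptions μ →
        LipEqSobolev μ c → WeakPoincareUpToScale μ K τ r) ∧
    -- (2) implies a weak Poincaré inequality up to some scale, quantitatively
    (∀ (C : ℝ≥0) (R : ℝ≥0∞), 1 ≤ C → 0 < R →
      ∃ (K τ : ℝ≥0) (r : ℝ≥0∞), 0 < K ∧ 1 ≤ τ ∧ 0 < r ∧
      ∀ (Z : Type u) [MetricSpace Z] [TopologicalSpace.SeparableSpace Z]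
        [MeasurableSpace Z] [BorelSpace Z] (μ : Measure Z), StandingAssumptions μ →
        VeryInftyThickQuasiconvex μ C R → WeakPoincareUpToScale μ K τ r) ∧
    -- doubling and a weak Poincaré inequality, both up to some scale, imply (2), quantitatively
    (∀ (D K τ : ℝ≥0) (r₁ r₂ : ℝ≥0∞), 0 < K → 1 ≤ τ → 0 < r₁ → 0 < r₂ →
      ∃ (C : ℝ≥0) (R : ℝ≥0∞), 1 ≤ C ∧ 0 < R ∧
      ∀ (Z : Type u) [MetricSpace Z] [TopologicalSpace.SeparableSpace Z]
        [MeasurableSpace Z] [BorelSpace Z] (μ : Measure Z), StandingAssumptions μ →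
        DoublingUpToScale μ D r₁ → WeakPoincareUpToScale μ K τ r₂ →
        VeryInftyThickQuasiconvex μ C R) := by
  have hC : ∀ {K : ℝ}, 0 ≤ K → 1 ≤ (2 * (K + 1)).toNNReal := fun {K} hK =>
    Real.one_le_toNNReal.2 (by linarith)
  refine ⟨fun c hc => ?_, fun C R _ hR => ?_, fun c hc => ?_, fun C R hC1 hR => ?_,
    fun D K τ r₁ r₂ _ _ h₁ h₂ => ?_⟩
  · exact ⟨_, _, hC (by positivity), ENNReal.ofReal_pos.2 (by positivity),
      fun Z _ _ _ _ μ hμ h => h.veryInftyThickQuasiconvex hμ hc⟩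
  -- `R` may be infinite, while the constant `2 / r` requires a finite scale.
  · obtain ⟨r, hr, hrR⟩ := exists_pos_nnreal_le hR
    exact ⟨(1 + C + 2 / r)⁻¹, by positivity,
      fun Z _ _ _ _ μ hμ h => (h.mono hrR).lipEqSobolev hμ.finitePositiveOnBalls hr⟩
  · exact ⟨_, _, _, one_pos.trans_le (hC (K := 2 / c + 1) (by positivity)), le_self_add,
      ENNReal.ofReal_pos.2 (by positivity), fun Z _ _ _ _ μ hμ h =>
        (h.veryInftyThickQuasiconvex hμ hc).weakPoincareUpToScale hμ.finitePositiveOnBalls⟩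
  · exact ⟨C, 1 + 2 * C, R, one_pos.trans_le hC1, le_self_add, hR,
      fun Z _ _ _ _ μ hμ h => h.weakPoincareUpToScale hμ.finitePositiveOnBalls⟩
  · obtain ⟨s, hs, hsr⟩ := exists_pos_nnreal_le (lt_min h₁ h₂)
    have hK : (0 : ℝ) ≤ 12 * D * K + 4 * D ^ 2 * K := by positivity
    have hs' : (0 : ℝ) < s / 2 := by positivity
    refine ⟨_, _, hC hK, ENNReal.ofReal_pos.2 (half_pos hs'), fun Z _ _ _ _ μ hμ hD hP => ?_⟩
    -- Here `M = (K' + 1) s / 2`, with `K'` the Lipschitz constant just found. The scale `s / 2`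
    -- keeps `2 d(x, y)` below both `r₁` and `r₂`.
    refine veryInftyThickQuasiconvex_of_forall_continuous hμ.locallyComplete hK hs' le_rfl ?_
    rintro v hv hvM ⟨ρ, hρ, hρ1⟩ x y hxy
    have hlt : ENNReal.ofReal (2 * dist x y) < s := by
      rw [← ENNReal.ofReal_coe_nnreal]
      exact (ENNReal.ofReal_lt_ofReal_iff (by positivity)).2 (by linarith)
    exact abs_sub_le_of_doubling_of_poincare hμ.finitePositiveOnBalls hD hP hv hvM hρ hρ1
      (hlt.trans_le (hsr.trans (min_le_left _ _))) (hlt.le.trans (hsr.trans (min_le_right _ _)))
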